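/- Let $k$ be a field, $\otimes=\otimes_k$, and let $B$ be a Hopf algebra over $k$ whose antipode $S$ is invertible (Sweedler notation $\Delta b=b_{(1)}\otimes b_{(2)}$). Let $A$ be a unital (hence $H$-unital) $B$-module algebra, i.e. $b(aa')=b_{(1)}(a)\,b_{(2)}(a')$ and $b(1)=\varepsilon(b)1$, that is projective as a $B$-module, and let $V$ be a $B$-equivariant $A$-bimodule, i.e. an $A$-bimodule and $B$-module with $b(av)=b_{(1)}(a)\,b_{(2)}(v)$ and $b(va)=b_{(1)}(v)\,b_{(2)}(a)$. Let ${\rm CH}_n(A,V)=A^{\otimes n}\otimes V$ be the Hochschild complex, with differential $$d(a_1\otimes\cdots\otimes a_n\otimes v)=a_2\otimes\cdots\otimes a_n\otimes va_1+\sum_{j=1}^{n-1}(-1)^j\,a_1\otimes\cdots\otimes a_ja_{j+1}\otimes\cdots\otimes a_n\otimes v+(-1)^n a_1\otimes\cdots\otimes a_{n-1}\otimes a_nv ,$$ let $L_b$ be the diagonal action of $b\in B$ on ${\rm CH}_n(A,V)$, and let $\partial(a_1\otimes\cdots\otimes a_n\otimes v)=a_2\otimes\cdots\otimes a_n\otimes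 va_1$. Let $J_*=\sum_{b\in B}{\rm im}\,[L_b,\partial]$, a subcomplex stable under $B$; then ${\rm QCH}_*={\rm CH}_*(A,V)/J_*$ is a differential graded $B$-module, and the Hopf--Hochschild homology of $A$ with coefficients in $V$ is $HH^{\rm Hopf}_n(A,V)=H_n(k\otimes_B{\rm QCH}_*)$. Let $A^e\rtimes B$ be $A\otimes A^{op}\otimes B$ with the multiplication $$(a_1\otimes a_1'\otimes b)(a_2\otimes a_2'\otimes b')=a_1b_{(1)}(a_2)\otimes b_{(3)}(a_2')a_1'\otimes b_{(2)}b' ,$$ a unital associative algebra. It acts from the left on $A^e=A\otimes A$ by $(a\otimes a'\otimes b)(x\otimes y)=a\,b_{(1)}(x)\otimes b_{(2)}(y)\,a'$ and on $A$ by $(a\otimes a'\otimes b)\,x=a\,b(x)\,a'$; let $\Omega(A)$ be the kernel of the multiplication map $A^e\to A$, a left $A^e\rtimes B$-module. Let $V^{op}$ be the right $A^e\rtimes B$-module generated by the $k$-module $V$ subject to the relations $v\cdot(a\otimes a'\otimes b)=S(b)(a'va)$. (If this formula defines a right action on $V$, for instance if $S^2={\rm id}$, then $V^{op}$ is $V$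 with this action.) Then for every $n\geq 1$ there is an isomorphism of $k$-modules $$HH^{\rm Hopf}_{n+1}(A,V)\;\cong\;{\rm Tor}^{A^e\rtimes B}_n(\Omega(A),V^{op}),$$ where ${\rm Tor}_n$ is the $n$-th left derived functor of $V^{op}\otimes_{A^e\rtimes B}-$ evaluated at $\Omega(A)$. -/

import Mathlib

open scoped TensorProduct
open CategoryTheory

universe u

namespace HopfHochschild

/-! ### Representations of a bialgebra and diagonal actions -/

section Diagonal

variable {k B : Type*} [Field k] [Ring B] [Bialgebra k B]
variable {M N P Q : Type*} [AddCommGroup M] [Module k M] [AddCommGroup N] [Module k N]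
  [AddCommGroup P] [Module k P] [AddCommGroup Q] [Module k Q]

/-- The diagonal action of a bialgebra on a tensor product of two `B`-modules:
`b (m ⊗ n) = ∑ b₍₁₎ m ⊗ b₍₂₎ n`. -/
noncomputable def diag (ρ : B →ₐ[k] Module.End k M) (σ : B →ₐ[k] Module.End k N) :
    B →ₐ[k] Module.End k (M ⊗[k] N) :=
  ((Module.endTensorEndAlgHom (R := k) (S := k) (A := k) (M := M) (N := N)).comp
    (Algebra.TensorProduct.map ρ σ)).comp (Bialgebra.comulAlgHom k B)

/-- `f` is a morphism of `B`-modules from `(M, ρ)` to `(N, σ)`. -/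
def Intertwines (ρ : B →ₐ[k] Module.End k M) (σ : B →ₐ[k] Module.End k N)
    (f : M →ₗ[k] N) : Prop :=
  ∀ (b : B) (m : M), f (ρ b m) = σ b (f m)

/-- The action of `B` on a `B`-module, as an algebra morphism to the `k`-linear endomorphisms. -/
noncomputable abbrev act (k B M : Type*) [Field k] [Ring B] [Algebra k B] [AddCommGroup M]
    [Module k M] [Module B M] [IsScalarTower k B M] : B →ₐ[k] Module.End k M :=
  Algebra.lsmul k k M

theorem diag_tmul (ρ : B →ₐ[k] Module.End k M) (σ : B →ₐ[k] Module.End k N) (b : B)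
    (m : M) (n : N) :
    diag ρ σ b (m ⊗ₜ n) =
      TensorProduct.map (ρ.toLinearMap.flip m) (σ.toLinearMap.flip n) (Coalgebra.comul b) := by
  have h : ∀ t : B ⊗[k] B,
      (Module.endTensorEndAlgHom (R := k) (S := k) (A := k) (M := M) (N := N))
        (Algebra.TensorProduct.map ρ σ t) (m ⊗ₜ n) =
      TensorProduct.map (ρ.toLinearMap.flip m) (σ.toLinearMap.flip n) t := by
    intro t
    induction t with
    | zero => simp
    | tmul x y => rfl
    | add x y hx hy => simp only [map_add, LinearMap.add_apply, hx, hy]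
  exact h _

/-- Sweedler's formula for the diagonal action. -/
theorem diag_tmul_sum (ρ : B →ₐ[k] Module.End k M) (σ : B →ₐ[k] Module.End k N) (b : B)
    {ι : Type*} (s : Coalgebra.Repr k b ι) (m : M) (n : N) :
    diag ρ σ b (m ⊗ₜ n) = ∑ i ∈ s.index, ρ (s.left i) m ⊗ₜ σ (s.right i) n := by
  rw [diag_tmul, ← s.eq, map_sum]
  rfl

theorem Intertwines.comp {ρ : B →ₐ[k] Module.End k M} {σ : B →ₐ[k] Module.End k N}
    {τ : B →ₐ[k] Module.End k P} {g : N →ₗ[k] P} {f : M →ₗ[k] N}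
    (hg : Intertwines σ τ g) (hf : Intertwines ρ σ f) : Intertwines ρ τ (g ∘ₗ f) := by
  intro b m
  simp [hf b m, hg b (f m)]

theorem Intertwines.lTensor {σ : B →ₐ[k] Module.End k N} {τ : B →ₐ[k] Module.End k P}
    {f : N →ₗ[k] P} (hf : Intertwines σ τ f) (ρ : B →ₐ[k] Module.End k M) :
    Intertwines (diag ρ σ) (diag ρ τ) (f.lTensor M) := by
  intro b t
  induction t with
  | zero => simp
  | add x y hx hy => simp only [map_add, hx, hy]
  | tmul m n =>
    rw [diag_tmul_sum ρ σ b (Coalgebra.Repr.arbitrary k b), LinearMap.lTensor_tmul,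
      diag_tmul_sum ρ τ b (Coalgebra.Repr.arbitrary k b), map_sum]
    exact Finset.sum_congr rfl fun i _ => by rw [LinearMap.lTensor_tmul, hf]

theorem Intertwines.rTensor {σ : B →ₐ[k] Module.End k N} {τ : B →ₐ[k] Module.End k P}
    {f : N →ₗ[k] P} (hf : Intertwines σ τ f) (ρ : B →ₐ[k] Module.End k M) :
    Intertwines (diag σ ρ) (diag τ ρ) (f.rTensor M) := by
  intro b t
  induction t with
  | zero => simp
  | add x y hx hy => simp only [map_add, hx, hy]
  | tmul m n =>
    rw [diag_tmul_sum σ ρ b (Coalgebra.Repr.arbitrary k b), LinearMap.rTensor_tmul,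
      diag_tmul_sum τ ρ b (Coalgebra.Repr.arbitrary k b), map_sum]
    exact Finset.sum_congr rfl fun i _ => by rw [LinearMap.rTensor_tmul, hf]

theorem intertwines_assoc (ρ : B →ₐ[k] Module.End k M) (σ : B →ₐ[k] Module.End k N)
    (τ : B →ₐ[k] Module.End k P) :
    Intertwines (diag (diag ρ σ) τ) (diag ρ (diag σ τ))
      (TensorProduct.assoc k M N P).toLinearMap := by
  intro b t
  suffices h : (TensorProduct.assoc k M N P).toLinearMap ∘ₗ diag (diag ρ σ) τ b =
      diag ρ (diag σ τ) b ∘ₗ (TensorProduct.assoc k M N P).toLinearMap from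
    LinearMap.congr_fun h t
  apply TensorProduct.ext_threefold
  intro m n p
  have h1 : (diag ρ σ).toLinearMap.flip (m ⊗ₜ n) =
      TensorProduct.map (ρ.toLinearMap.flip m) (σ.toLinearMap.flip n) ∘ₗ Coalgebra.comul :=
    LinearMap.ext fun b => diag_tmul ρ σ b m n
  have h2 : (diag σ τ).toLinearMap.flip (n ⊗ₜ p) =
      TensorProduct.map (σ.toLinearMap.flip n) (τ.toLinearMap.flip p) ∘ₗ Coalgebra.comul :=
    LinearMap.ext fun b => diag_tmul σ τ b n p
  simp only [LinearMap.comp_apply, LinearEquiv.coe_coe, TensorProduct.assoc_tmul]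
  rw [diag_tmul, diag_tmul, h1, h2]
  have h3 : ∀ x : B ⊗[k] B, TensorProduct.assoc k M N P (TensorProduct.map
      (TensorProduct.map (ρ.toLinearMap.flip m) (σ.toLinearMap.flip n) ∘ₗ Coalgebra.comul)
      (τ.toLinearMap.flip p) x) =
      TensorProduct.map (ρ.toLinearMap.flip m)
        (TensorProduct.map (σ.toLinearMap.flip n) (τ.toLinearMap.flip p))
        (TensorProduct.assoc k B B B (Coalgebra.comul.rTensor B x)) := by
    intro x
    induction x with
    | zero => simp
    | add x y hx hy => simp only [map_add, hx, hy]
    | tmul x y =>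
      simp only [TensorProduct.map_tmul, LinearMap.comp_apply, LinearMap.rTensor_tmul]
      generalize (Coalgebra.comul (R := k) x) = z
      induction z with
      | zero => simp
      | add x y hx hy => simp only [map_add, TensorProduct.add_tmul, hx, hy]
      | tmul z w => simp
  rw [h3, Coalgebra.coassoc_apply]
  generalize (Coalgebra.comul (R := k) b) = x
  induction x with
  | zero => simp
  | add x y hx hy => simp only [map_add, hx, hy]
  | tmul x y => simp

theorem intertwines_assoc_symm (ρ : B →ₐ[k] Module.End k M) (σ : B →ₐ[k] Module.End k N)
    (τ : B →ₐ[k] Module.End k P) :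
    Intertwines (diag ρ (diag σ τ)) (diag (diag ρ σ) τ)
      (TensorProduct.assoc k M N P).symm.toLinearMap := by
  intro b t
  apply (TensorProduct.assoc k M N P).injective
  have h := intertwines_assoc ρ σ τ b ((TensorProduct.assoc k M N P).symm t)
  simp only [LinearEquiv.coe_coe, LinearEquiv.apply_symm_apply] at h ⊢
  exact h.symm

end Diagonal

/-! ### Module algebras and equivariant bimodules -/

/-- `A` is a (unital) left `B`-module algebra:
`b (a a') = ∑ b₍₁₎(a) b₍₂₎(a')` and `b 1 = ε(b) 1`. -/
class IsModuleAlgebra (k B A : Type*) [Field k] [Ring B] [Bialgebra k B] [Ring A] [Algebra k A]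
    [Module B A] [IsScalarTower k B A] : Prop where
  smul_mul : ∀ (b : B) (a a' : A),
    b • (a * a') = LinearMap.mul' k A (diag (act k B A) (act k B A) b (a ⊗ₜ a'))
  smul_one : ∀ b : B, b • (1 : A) = Coalgebra.counit (R := k) b • (1 : A)

section Bimodules

variable (k B A : Type*) [Field k] [Ring B] [Bialgebra k B] [Ring A] [Algebra k A]
  [Module B A] [IsScalarTower k B A]

/-- The structure of a `B`-equivariant `A`-bimodule on a `k`-module `Y`: an action `ρ` of `B`, a left
action `l` and a right action `r` of `A` that commute with each other, such that
`b (a y) = ∑ b₍₁₎(a) b₍₂₎(y)` and `b (y a) = ∑ b₍₁₎(y) b₍₂₎(a)`. -/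
structure EquivariantStructure (Y : Type*) [AddCommGroup Y] [Module k Y] where
  ρ : B →ₐ[k] Module.End k Y
  l : A →ₐ[k] Module.End k Y
  r : Aᵐᵒᵖ →ₐ[k] Module.End k Y
  comm : ∀ a a' y, l a (r a' y) = r a' (l a y)
  left : Intertwines (diag (act k B A) ρ) ρ (TensorProduct.lift l.toLinearMap)
  right : Intertwines (diag ρ (act k B A)) ρ
    (TensorProduct.lift (r.toLinearMap ∘ₗ (MulOpposite.opLinearEquiv k).toLinearMap).flip)

/-- `V`, which is both an `A`-bimodule and a `B`-module, is a `B`-equivariant `A`-bimodule: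
`b (a v) = ∑ b₍₁₎(a) b₍₂₎(v)` and `b (v a) = ∑ b₍₁₎(v) b₍₂₎(a)`.
The right action of `a` is `MulOpposite.op a • v`. -/
class IsEquivariantBimodule (V : Type*) [AddCommGroup V] [Module k V] [Module A V]
    [IsScalarTower k A V] [Module Aᵐᵒᵖ V] [IsScalarTower k Aᵐᵒᵖ V] [SMulCommClass A Aᵐᵒᵖ V]
    [Module B V] [IsScalarTower k B V] : Prop where
  smul_left : ∀ (b : B) (a : A) (v : V), b • (a • v) =
    TensorProduct.lift (Algebra.lsmul k k V : A →ₐ[k] Module.End k V).toLinearMap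
      (diag (act k B A) (act k B V) b (a ⊗ₜ v))
  smul_right : ∀ (b : B) (v : V) (a : A), b • (MulOpposite.op a • v) =
    TensorProduct.lift ((Algebra.lsmul k k V : Aᵐᵒᵖ →ₐ[k] Module.End k V).toLinearMap ∘ₗ
      (MulOpposite.opLinearEquiv k).toLinearMap).flip
      (diag (act k B V) (act k B A) b (v ⊗ₜ a))

/-- The structure carried by a `B`-equivariant `A`-bimodule. -/
noncomputable def EquivariantStructure.of (V : Type*) [AddCommGroup V] [Module k V] [Module A V]
    [IsScalarTower k A V] [Module Aᵐᵒᵖ V] [IsScalarTower k Aᵐᵒᵖ V] [SMulCommClass A Aᵐᵒᵖ V]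
    [Module B V] [IsScalarTower k B V] [h : IsEquivariantBimodule k B A V] :
    EquivariantStructure k B A V where
  ρ := act k B V
  l := Algebra.lsmul k k V
  r := Algebra.lsmul k k V
  comm a a' y := smul_comm a a' y
  left := by
    intro b t
    induction t with
    | zero => simp
    | add x y hx hy => simp only [map_add, hx, hy]
    | tmul a v => exact (h.smul_left b a v).symm
  right := by
    intro b t
    induction t with
    | zero => simp
    | add x y hx hy => simp only [map_add, hx, hy]
    | tmul v a => exact (h.smul_right b v a).symm

instance [h : IsModuleAlgebra k B A] : IsEquivariantBimodule k B A A where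
  smul_left b a v := by
    rw [smul_eq_mul, h.smul_mul]
    rfl
  smul_right b v a := by
    rw [op_smul_eq_mul, h.smul_mul]
    congr 1

variable {k B A}

theorem intertwines_mul' [h : IsModuleAlgebra k B A] :
    Intertwines (diag (act k B A) (act k B A)) (act k B A) (LinearMap.mul' k A) := by
  intro b t
  induction t with
  | zero => simp
  | add x y hx hy => simp only [map_add, hx, hy]
  | tmul a v => exact (h.smul_mul b a v).symm

theorem diag_one_left [h : IsModuleAlgebra k B A] {M : Type*} [AddCommGroup M] [Module k M]
    (σ : B →ₐ[k] Module.End k M) (b : B) (m : M) :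
    diag (act k B A) σ b ((1 : A) ⊗ₜ m) = (1 : A) ⊗ₜ σ b m := by
  have h1 : (act k B A).toLinearMap.flip (1 : A) =
      (LinearMap.toSpanSingleton k A 1) ∘ₗ Coalgebra.counit :=
    LinearMap.ext fun b => h.smul_one b
  rw [diag_tmul, h1, ← LinearMap.comp_id (σ.toLinearMap.flip m), TensorProduct.map_comp,
    LinearMap.comp_apply]
  have h2 := Coalgebra.rTensor_counit_comul (R := k) b
  rw [LinearMap.rTensor] at h2
  rw [h2]
  simp

theorem diag_one_right [h : IsModuleAlgebra k B A] {M : Type*} [AddCommGroup M] [Module k M]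
    (σ : B →ₐ[k] Module.End k M) (b : B) (m : M) :
    diag σ (act k B A) b (m ⊗ₜ (1 : A)) = σ b m ⊗ₜ (1 : A) := by
  have h1 : (act k B A).toLinearMap.flip (1 : A) =
      (LinearMap.toSpanSingleton k A 1) ∘ₗ Coalgebra.counit :=
    LinearMap.ext fun b => h.smul_one b
  rw [diag_tmul, h1, ← LinearMap.comp_id (σ.toLinearMap.flip m), TensorProduct.map_comp,
    LinearMap.comp_apply]
  have h2 := Coalgebra.lTensor_counit_comul (R := k) b
  rw [LinearMap.lTensor] at h2
  rw [h2]
  simp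

/-- For a `B`-module `M` and an `A`-bimodule-like left factor, the map
`a ⊗ (a' ⊗ m) ↦ a a' ⊗ m` is `B`-linear. -/
theorem intertwines_mul_left [IsModuleAlgebra k B A] {M : Type*} [AddCommGroup M] [Module k M]
    (σ : B →ₐ[k] Module.End k M) :
    Intertwines (diag (act k B A) (diag (act k B A) σ)) (diag (act k B A) σ)
      (TensorProduct.lift (Algebra.lsmul k k (A ⊗[k] M) :
        A →ₐ[k] Module.End k (A ⊗[k] M)).toLinearMap) := by
  have h : TensorProduct.lift (Algebra.lsmul k k (A ⊗[k] M) :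
        A →ₐ[k] Module.End k (A ⊗[k] M)).toLinearMap =
      (LinearMap.mul' k A).rTensor M ∘ₗ (TensorProduct.assoc k A A M).symm.toLinearMap := by
    ext a a' m
    simp [TensorProduct.smul_tmul']
  rw [h]
  exact (intertwines_mul'.rTensor σ).comp (intertwines_assoc_symm _ _ _)

/-- If `g : Y ⊗ A → Y` is `B`-linear, then so is `(m ⊗ y) ⊗ a ↦ m ⊗ g (y ⊗ a)`. -/
theorem intertwines_right_lTensor {M Y : Type*} [AddCommGroup M] [Module k M]
    [AddCommGroup Y] [Module k Y] (σ : B →ₐ[k] Module.End k M) (ρ : B →ₐ[k] Module.End k Y)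
    (r : Aᵐᵒᵖ →ₐ[k] Module.End k Y)
    (h : Intertwines (diag ρ (act k B A)) ρ (TensorProduct.lift
      (r.toLinearMap ∘ₗ (MulOpposite.opLinearEquiv k).toLinearMap).flip)) :
    Intertwines (diag (diag σ ρ) (act k B A)) (diag σ ρ) (TensorProduct.lift
      (((Module.End.lTensorAlgHom k Y M).comp r).toLinearMap ∘ₗ
        (MulOpposite.opLinearEquiv k).toLinearMap).flip) := by
  have h' : TensorProduct.lift (((Module.End.lTensorAlgHom k Y M).comp r).toLinearMap ∘ₗ
        (MulOpposite.opLinearEquiv k).toLinearMap).flip =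
      (TensorProduct.lift (r.toLinearMap ∘ₗ
        (MulOpposite.opLinearEquiv k).toLinearMap).flip).lTensor M ∘ₗ
        (TensorProduct.assoc k M Y A).toLinearMap := by
    ext m y a
    rfl
  rw [h']
  exact (h.lTensor σ).comp (intertwines_assoc _ _ _)

end Bimodules

/-- `A ⊗ A` with the outer bimodule structure and the diagonal action of `B`:
`a (x ⊗ y) a' = a x ⊗ y a'`, `b (x ⊗ y) = ∑ b₍₁₎(x) ⊗ b₍₂₎(y)`. -/
noncomputable def EquivariantStructure.outer (k B A : Type*) [Field k] [Ring B] [Bialgebra k B]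
    [Ring A] [Algebra k A] [Module B A] [IsScalarTower k B A] [IsModuleAlgebra k B A] :
    EquivariantStructure k B A (A ⊗[k] A) where
  ρ := diag (act k B A) (act k B A)
  l := Algebra.lsmul k k (A ⊗[k] A)
  r := (Module.End.lTensorAlgHom k A A).comp (EquivariantStructure.of k B A A).r
  comm a a' t := by
    induction t with
    | zero => simp
    | add x y hx hy => simp only [map_add, hx, hy]
    | tmul x y => rfl
  left := intertwines_mul_left _
  right := intertwines_right_lTensor _ _ _ (EquivariantStructure.of k B A A).right

/-- `A ⊗ M ⊗ A` for a `B`-module `M`, with the outer bimodule structure and the diagonal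
action of `B`. -/
noncomputable def EquivariantStructure.induced {k B : Type*} (A : Type*) [Field k] [Ring B] [Bialgebra k B]
    [Ring A] [Algebra k A] [Module B A] [IsScalarTower k B A] [IsModuleAlgebra k B A] {M : Type*} [AddCommGroup M] [Module k M]
    (σ : B →ₐ[k] Module.End k M) :
    EquivariantStructure k B A (A ⊗[k] (M ⊗[k] A)) where
  ρ := diag (act k B A) (diag σ (act k B A))
  l := Algebra.lsmul k k (A ⊗[k] (M ⊗[k] A))
  r := (Module.End.lTensorAlgHom k (M ⊗[k] A) A).comp
    ((Module.End.lTensorAlgHom k A M).comp (EquivariantStructure.of k B A A).r)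
  comm a a' t := by
    induction t with
    | zero => simp
    | add x y hx hy => simp only [map_add, hx, hy]
    | tmul x y => rfl
  left := intertwines_mul_left _
  right := intertwines_right_lTensor _ _ _
    (intertwines_right_lTensor _ _ _ (EquivariantStructure.of k B A A).right)

/-! ### The crossed product algebra `Aᵉ ⋊ B` -/

/-- The crossed product `Aᵉ ⋊ B`. Its underlying `k`-module is `A ⊗ A ⊗ B`; the factors are stored
in the order `A ⊗ (B ⊗ A)`, so that `a ⊗ₜ (b ⊗ₜ a')` stands for `a ⊗ a' ⊗ b`, the operator
`y ↦ a (b y) a'`. -/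
def CrossedProduct (k B A : Type*) [Field k] [Ring B] [Bialgebra k B] [Ring A] [Algebra k A] :
    Type _ :=
  A ⊗[k] (B ⊗[k] A)

section CrossedProduct

variable (k B A : Type*) [Field k] [Ring B] [Bialgebra k B] [Ring A] [Algebra k A]

noncomputable instance : AddCommGroup (CrossedProduct k B A) :=
  inferInstanceAs (AddCommGroup (A ⊗[k] (B ⊗[k] A)))

noncomputable instance : Module k (CrossedProduct k B A) :=
  inferInstanceAs (Module k (A ⊗[k] (B ⊗[k] A)))

variable {k B A}

/-- The element `a ⊗ a' ⊗ b` of the crossed product. -/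
def CrossedProduct.mk (a a' : A) (b : B) : CrossedProduct k B A :=
  a ⊗ₜ[k] (b ⊗ₜ[k] a')

noncomputable instance : One (CrossedProduct k B A) := ⟨CrossedProduct.mk 1 1 1⟩

theorem CrossedProduct.induction_on {p : CrossedProduct k B A → Prop} (x : CrossedProduct k B A)
    (zero : p 0) (mk : ∀ a a' b, p (CrossedProduct.mk a a' b))
    (add : ∀ x y, p x → p y → p (x + y)) : p x := by
  refine TensorProduct.induction_on (motive := p) x zero (fun a z => ?_) add
  refine TensorProduct.induction_on (motive := fun z => p (a ⊗ₜ[k] z : A ⊗[k] (B ⊗[k] A)))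
    z ?_ (fun b a' => mk a a' b) (fun z w hz hw => ?_)
  · rw [TensorProduct.tmul_zero]; exact zero
  · rw [TensorProduct.tmul_add]; exact add _ _ hz hw

variable [Module B A] [IsScalarTower k B A]

/-- The operator on an equivariant bimodule given by an element of the crossed product:
`(a ⊗ a' ⊗ b) y = a (b y) a'`. -/
noncomputable def EquivariantStructure.crossAct {Y : Type*} [AddCommGroup Y] [Module k Y]
    (D : EquivariantStructure k B A Y) : CrossedProduct k B A →ₗ[k] Module.End k Y :=
  LinearMap.mul' k (Module.End k Y) ∘ₗ TensorProduct.map D.l.toLinearMap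
    (LinearMap.mul' k (Module.End k Y) ∘ₗ
      TensorProduct.map (D.r.toLinearMap ∘ₗ (MulOpposite.opLinearEquiv k).toLinearMap)
        D.ρ.toLinearMap ∘ₗ
      (TensorProduct.comm k B A).toLinearMap)

theorem EquivariantStructure.crossAct_mk {Y : Type*} [AddCommGroup Y] [Module k Y]
    (D : EquivariantStructure k B A Y) (a a' : A) (b : B) (y : Y) :
    D.crossAct (CrossedProduct.mk a a' b) y = D.l a (D.r (MulOpposite.op a') (D.ρ b y)) :=
  rfl

theorem EquivariantStructure.crossAct_rho {Y : Type*} [AddCommGroup Y] [Module k Y]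
    (D : EquivariantStructure k B A Y) (b : B) (x : A ⊗[k] (B ⊗[k] A)) (y : Y) :
    D.crossAct (diag (act k B A) (diag (act k B B) (act k B A)) b x) y =
      D.ρ b (D.crossAct x y) := by
  have h0 : Intertwines (act k B B) D.ρ (D.ρ.toLinearMap.flip y) := by
    intro b c
    simp
  have h1 := D.left.comp ((D.right.comp (h0.rTensor (act k B A))).lTensor (act k B A))
  have h2 : (D.crossAct.flip y : A ⊗[k] (B ⊗[k] A) →ₗ[k] Y) =
      TensorProduct.lift D.l.toLinearMap ∘ₗ
        (TensorProduct.lift (D.r.toLinearMap ∘ₗ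
          (MulOpposite.opLinearEquiv k).toLinearMap).flip ∘ₗ
          (D.ρ.toLinearMap.flip y).rTensor A).lTensor A :=
    TensorProduct.ext (LinearMap.ext fun a => TensorProduct.ext' fun b c => rfl)
  have h3 := h1 b x
  rw [← h2] at h3
  exact h3

theorem EquivariantStructure.crossAct_one {Y : Type*} [AddCommGroup Y] [Module k Y]
    (D : EquivariantStructure k B A Y) (y : Y) : D.crossAct 1 y = y := by
  change D.crossAct (CrossedProduct.mk 1 1 1) y = y
  rw [D.crossAct_mk]
  simp

variable [IsModuleAlgebra k B A]

/-- The crossed product as an equivariant bimodule: `A ⊗ B ⊗ A` with the outer action of `A` and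
the diagonal action of `B`. -/
noncomputable def CrossedProduct.bimodule (k B A : Type*) [Field k] [Ring B] [Bialgebra k B]
    [Ring A] [Algebra k A] [Module B A] [IsScalarTower k B A] [IsModuleAlgebra k B A] :
    EquivariantStructure k B A (CrossedProduct k B A) :=
  EquivariantStructure.induced A (act k B B)

/-- The multiplication of the crossed product:
`(a₁ ⊗ a₁' ⊗ b) (a₂ ⊗ a₂' ⊗ b') = ∑ a₁ b₍₁₎(a₂) ⊗ b₍₃₎(a₂') a₁' ⊗ b₍₂₎ b'`. -/
noncomputable instance : Mul (CrossedProduct k B A) :=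
  ⟨fun x y => (CrossedProduct.bimodule k B A).crossAct x y⟩

theorem CrossedProduct.mul_def (x y : CrossedProduct k B A) :
    x * y = (CrossedProduct.bimodule k B A).crossAct x y := rfl

theorem EquivariantStructure.crossAct_mul {Y : Type*} [AddCommGroup Y] [Module k Y]
    (D : EquivariantStructure k B A Y) (x x' : CrossedProduct k B A) (y : Y) :
    D.crossAct (x * x') y = D.crossAct x (D.crossAct x' y) := by
  have hl : ∀ (a : A) (z : CrossedProduct k B A),
      D.crossAct ((CrossedProduct.bimodule k B A).l a z) y = D.l a (D.crossAct z y) := by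
    intro a z
    induction z using CrossedProduct.induction_on with
    | zero => simp
    | add z w hz hw => simp only [map_add, LinearMap.add_apply, hz, hw]
    | mk c c' b =>
      have : (CrossedProduct.bimodule k B A).l a (CrossedProduct.mk c c' b) =
        CrossedProduct.mk (a * c) c' b := rfl
      rw [this, D.crossAct_mk, D.crossAct_mk, map_mul]
      rfl
  have hr : ∀ (a : A) (z : CrossedProduct k B A),
      D.crossAct ((CrossedProduct.bimodule k B A).r (MulOpposite.op a) z) y =
        D.r (MulOpposite.op a) (D.crossAct z y) := by
    intro a z
    induction z using CrossedProduct.induction_on with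
    | zero => simp
    | add z w hz hw => simp only [map_add, LinearMap.add_apply, hz, hw]
    | mk c c' b =>
      have : (CrossedProduct.bimodule k B A).r (MulOpposite.op a) (CrossedProduct.mk c c' b) =
        CrossedProduct.mk c (c' * a) b := rfl
      rw [this, D.crossAct_mk, D.crossAct_mk, ← D.comm, MulOpposite.op_mul, map_mul]
      rfl
  rw [CrossedProduct.mul_def]
  induction x using CrossedProduct.induction_on with
  | zero => simp
  | add z w hz hw => simp only [map_add, LinearMap.add_apply, hz, hw]
  | mk a a' b =>
    rw [EquivariantStructure.crossAct_mk, hl, hr, D.crossAct_mk]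
    congr 2
    exact D.crossAct_rho b x' y

noncomputable instance : Ring (CrossedProduct k B A) :=
  { (inferInstance : AddCommGroup (CrossedProduct k B A)) with
    mul := (· * ·)
    one := 1
    left_distrib := fun x y z => by simp only [CrossedProduct.mul_def, map_add]
    right_distrib := fun x y z => by
      simp only [CrossedProduct.mul_def, map_add, LinearMap.add_apply]
    zero_mul := fun x => by simp only [CrossedProduct.mul_def, map_zero, LinearMap.zero_apply]
    mul_zero := fun x => by simp only [CrossedProduct.mul_def, map_zero]
    mul_assoc := fun x y z => (CrossedProduct.bimodule k B A).crossAct_mul x y z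
    one_mul := fun x => (CrossedProduct.bimodule k B A).crossAct_one x
    mul_one := fun x => by
      rw [CrossedProduct.mul_def]
      induction x using CrossedProduct.induction_on with
      | zero => simp
      | add z w hz hw => rw [map_add, LinearMap.add_apply, hz, hw]
      | mk a a' b =>
        rw [EquivariantStructure.crossAct_mk]
        have h : (CrossedProduct.bimodule k B A).ρ b (1 : CrossedProduct k B A) =
            CrossedProduct.mk 1 1 b := by
          have h1 := diag_one_left (k := k) (A := A) (diag (act k B B) (act k B A)) b
            ((1 : B) ⊗ₜ[k] (1 : A))
          rw [diag_one_right] at h1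
          refine h1.trans ?_
          change (1 : A) ⊗ₜ[k] ((b * 1) ⊗ₜ[k] (1 : A)) = _
          rw [mul_one]
          rfl
        rw [h]
        change (a * 1) ⊗ₜ[k] (b ⊗ₜ[k] (1 * a')) = _
        rw [mul_one, one_mul]
        rfl }

noncomputable instance : Algebra k (CrossedProduct k B A) :=
  Algebra.ofModule
    (fun c x y => by simp only [CrossedProduct.mul_def, map_smul, LinearMap.smul_apply])
    (fun c x y => by simp only [CrossedProduct.mul_def, map_smul])

/-- An equivariant `A`-bimodule is a left module over the crossed product. -/
@[reducible]
noncomputable def EquivariantStructure.module {Y : Type*} [AddCommGroup Y] [Module k Y]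
    (D : EquivariantStructure k B A Y) : Module (CrossedProduct k B A) Y where
  smul x y := D.crossAct x y
  one_smul y := D.crossAct_one y
  mul_smul x x' y := D.crossAct_mul x x' y
  smul_zero x := map_zero _
  smul_add x y z := map_add _ _ _
  add_smul x x' y := by
    change D.crossAct (x + x') y = _
    rw [map_add]
    rfl
  zero_smul y := by
    change D.crossAct 0 y = _
    rw [map_zero]
    rfl

end CrossedProduct

/-! ### The kernel `Ω(A)` of the multiplication map -/

section Omega

variable (k B A : Type*) [Field k] [Ring B] [Bialgebra k B] [Ring A] [Algebra k A]
  [Module B A] [IsScalarTower k B A] [IsModuleAlgebra k B A]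

variable {k B A} in
theorem mul'_crossAct (r : CrossedProduct k B A) (t : A ⊗[k] A) :
    LinearMap.mul' k A ((EquivariantStructure.outer k B A).crossAct r t) =
      (EquivariantStructure.of k B A A).crossAct r (LinearMap.mul' k A t) := by
  induction r using CrossedProduct.induction_on with
  | zero => simp
  | add x y hx hy => simp only [map_add, LinearMap.add_apply, hx, hy]
  | mk a a' b =>
    rw [EquivariantStructure.crossAct_mk, EquivariantStructure.crossAct_mk]
    have hb : LinearMap.mul' k A ((EquivariantStructure.outer k B A).ρ b t) =
        (EquivariantStructure.of k B A A).ρ b (LinearMap.mul' k A t) := intertwines_mul' b t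
    rw [← hb]
    generalize (EquivariantStructure.outer k B A).ρ b t = z
    induction z using TensorProduct.induction_on with
    | zero => simp
    | add x y hx hy => simp only [map_add, hx, hy]
    | tmul x y =>
      change a * x * (y * a') = a * (x * y * a')
      simp only [mul_assoc]

/-- The left `Aᵉ ⋊ B`-module `A`: `(a ⊗ a' ⊗ b) x = a b(x) a'`. -/
noncomputable instance : Module (CrossedProduct k B A) A :=
  (EquivariantStructure.of k B A A).module

/-- The left `Aᵉ ⋊ B`-module `Aᵉ`, that is `A ⊗ A` with
`(a ⊗ a' ⊗ b) (x ⊗ y) = ∑ a b₍₁₎(x) ⊗ b₍₂₎(y) a'`. -/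
def Enveloping (k A : Type*) [Field k] [Ring A] [Algebra k A] : Type _ := A ⊗[k] A

noncomputable instance : AddCommGroup (Enveloping k A) :=
  inferInstanceAs (AddCommGroup (A ⊗[k] A))

noncomputable instance : Module k (Enveloping k A) :=
  inferInstanceAs (Module k (A ⊗[k] A))

noncomputable instance : Module (CrossedProduct k B A) (Enveloping k A) :=
  (EquivariantStructure.outer k B A).module

/-- The multiplication map `Aᵉ → A`, a morphism of left `Aᵉ ⋊ B`-modules. -/
noncomputable def mulMap : Enveloping k A →ₗ[CrossedProduct k B A] A where
  toFun := LinearMap.mul' k A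
  map_add' := map_add (LinearMap.mul' k A)
  map_smul' r t := mul'_crossAct r t

/-- `Ω(A)`, the kernel of the multiplication map `Aᵉ → A`, as a left `Aᵉ ⋊ B`-module. -/
noncomputable def Omega : Submodule (CrossedProduct k B A) (Enveloping k A) :=
  LinearMap.ker (mulMap k B A)

end Omega

/-! ### The right module `Vᵒᵖ` -/

section Generated

variable (k R : Type*) {V : Type*} [Field k] [Ring R] [Algebra k R] [AddCommGroup V] [Module k V]
  (φ : R →ₗ[k] Module.End k V)

/-- The relations `[v] r = [φ(r)(v)]`, as a right submodule of the free right `R`-module `V ⊗ R` on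
the `k`-module `V`. The factors are stored in the order `R ⊗ V`: the pure tensor `r ⊗ₜ v` stands for
`[v] r`, and `s` acts by `r ⊗ₜ v ↦ (r * s) ⊗ₜ v`. -/
def generatedRelations : Submodule Rᵐᵒᵖ (R ⊗[k] V) :=
  Submodule.span Rᵐᵒᵖ {t | ∃ (r : R) (v : V), t = r ⊗ₜ[k] v - 1 ⊗ₜ[k] φ r v}

/-- The right `R`-module generated by the `k`-module `V` subject to the relations
`[v] r = [φ(r)(v)]`. If `φ` is a right action of `R` on `V`, this is `V` with that action, see
`Generated.mk_bijective`. -/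
def Generated : Type _ := (R ⊗[k] V) ⧸ generatedRelations k R φ

noncomputable instance : AddCommGroup (Generated k R φ) :=
  inferInstanceAs (AddCommGroup ((R ⊗[k] V) ⧸ generatedRelations k R φ))

noncomputable instance : Module Rᵐᵒᵖ (Generated k R φ) :=
  inferInstanceAs (Module Rᵐᵒᵖ ((R ⊗[k] V) ⧸ generatedRelations k R φ))

noncomputable instance : Module k (Generated k R φ) :=
  inferInstanceAs (Module k ((R ⊗[k] V) ⧸ generatedRelations k R φ))

instance : IsScalarTower k Rᵐᵒᵖ (Generated k R φ) :=
  inferInstanceAs (IsScalarTower k Rᵐᵒᵖ ((R ⊗[k] V) ⧸ generatedRelations k R φ))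

/-- The class `[v]` of an element of `V`. -/
noncomputable def Generated.mk : V →ₗ[k] Generated k R φ :=
  ((generatedRelations k R φ).mkQ.restrictScalars k) ∘ₗ TensorProduct.mk k R V 1

theorem Generated.op_smul_mk (r : R) (v : V) :
    MulOpposite.op r • Generated.mk k R φ v = Generated.mk k R φ (φ r v) := by
  refine (Submodule.Quotient.eq (generatedRelations k R φ)).2 (Submodule.subset_span ⟨r, v, ?_⟩)
  change (1 * r) ⊗ₜ[k] v - 1 ⊗ₜ[k] φ r v = _
  rw [one_mul]

/-- If `φ` is a right action of `R` on `V`, then `V → Generated k R φ` is a bijection, and by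
`Generated.op_smul_mk` an isomorphism of right `R`-modules. -/
theorem Generated.mk_bijective (h1 : ∀ v, φ 1 v = v)
    (h : ∀ (r s : R) (v : V), φ (r * s) v = φ s (φ r v)) :
    Function.Bijective (Generated.mk k R φ) := by
  let f : R ⊗[k] V →ₗ[k] V := TensorProduct.lift φ
  have hs : ∀ (s : R) (t : R ⊗[k] V), f (MulOpposite.op s • t) = φ s (f t) := by
    intro s t
    induction t with
    | zero => simp
    | add x y hx hy => rw [smul_add, map_add, hx, hy, map_add, map_add]
    | tmul r v => exact h r s v
  have hker : ∀ t ∈ generatedRelations k R φ, f t = 0 := by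
    intro t ht
    induction ht using Submodule.span_induction with
    | mem t ht =>
      obtain ⟨r, v, rfl⟩ := ht
      rw [map_sub, sub_eq_zero]
      exact (h1 _).symm
    | zero => exact map_zero f
    | add x y _ _ hx hy => rw [map_add, hx, hy, add_zero]
    | smul s x _ hx =>
      have := hs s.unop x
      rw [MulOpposite.op_unop] at this
      rw [this, hx, map_zero]
  constructor
  · intro v w hvw
    have h2 := hker _ ((Submodule.Quotient.eq (generatedRelations k R φ)).1 hvw)
    rw [map_sub, sub_eq_zero] at h2
    exact (h1 v).symm.trans (h2.trans (h1 w))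
  · intro x
    obtain ⟨t, rfl⟩ := Submodule.Quotient.mk_surjective (generatedRelations k R φ) x
    refine ⟨f t, ?_⟩
    induction t with
    | zero => rw [map_zero, map_zero]; rfl
    | add x y hx hy => rw [map_add, map_add, hx, hy]; rfl
    | tmul r v =>
      exact ((Submodule.Quotient.eq (generatedRelations k R φ)).2
        (Submodule.subset_span ⟨r, v, rfl⟩)).symm

end Generated

section Opposite

variable (k B A V : Type*) [Field k] [Ring B] [HopfAlgebra k B] [Ring A] [Algebra k A]
  [AddCommGroup V] [Module k V] [Module A V] [IsScalarTower k A V]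
  [Module Aᵐᵒᵖ V] [IsScalarTower k Aᵐᵒᵖ V] [Module B V] [IsScalarTower k B V]

/-- The assignment `v · (a ⊗ a' ⊗ b) = S(b) (a' v a)` that turns the left actions on `V` into
right actions by means of the antipode `S`. -/
noncomputable def opAct : CrossedProduct k B A →ₗ[k] Module.End k V :=
  LinearMap.mul' k (Module.End k V) ∘ₗ
    TensorProduct.map
      (LinearMap.mul' k (Module.End k V) ∘ₗ
        TensorProduct.map ((act k B V).toLinearMap ∘ₗ HopfAlgebra.antipode k)
          (Algebra.lsmul k k V : A →ₐ[k] Module.End k V).toLinearMap)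
      ((Algebra.lsmul k k V : Aᵐᵒᵖ →ₐ[k] Module.End k V).toLinearMap ∘ₗ
        (MulOpposite.opLinearEquiv k).toLinearMap) ∘ₗ
    (TensorProduct.comm k A (B ⊗[k] A)).toLinearMap

theorem opAct_mk (a a' : A) (b : B) (v : V) :
    opAct k B A V (CrossedProduct.mk a a' b) v =
      HopfAlgebra.antipode k b • a' • MulOpposite.op a • v := rfl

/-- `Vᵒᵖ`: the right `Aᵉ ⋊ B`-module generated by the `k`-module `V` subject to the relations
`v (a ⊗ a' ⊗ b) = S(b) (a' v a)`. If this formula defines a right action of `Aᵉ ⋊ B` on `V`, then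
`Vᵒᵖ` is `V` with that action. -/
abbrev Op [Module B A] [IsScalarTower k B A] [IsModuleAlgebra k B A] : Type _ :=
  Generated k (CrossedProduct k B A) (opAct k B A V)

end Opposite

/-! ### `Tor` over a noncommutative algebra -/

section Tor

open scoped ModuleCat

/-- The relations `w r ⊗ y = w ⊗ r y` of the tensor product over `R`. -/
def balancedRelations (k R W Y : Type*) [Field k] [Ring R] [AddCommGroup W] [Module k W]
    [Module Rᵐᵒᵖ W] [AddCommGroup Y] [Module k Y] [Module R Y] : Submodule k (W ⊗[k] Y) :=
  Submodule.span k {t | ∃ (w : W) (r : R) (y : Y),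
    t = (MulOpposite.op r • w) ⊗ₜ[k] y - w ⊗ₜ[k] (r • y)}

variable (k R W : Type u) [Field k] [Ring R] [Algebra k R] [AddCommGroup W] [Module k W]
  [Module Rᵐᵒᵖ W]

/-- The functor `W ⊗_R -` from left `R`-modules to `k`-modules, for a right module `W` over a
`k`-algebra `R`. -/
noncomputable def tensorFunctor : ModuleCat.{u} R ⥤ ModuleCat.{u} k where
  obj Y := ModuleCat.of k ((W ⊗[k] Y) ⧸ balancedRelations k R W Y)
  map {Y Z} f := ModuleCat.ofHom (Submodule.mapQ _ _
    ((f.hom.restrictScalars k).lTensor W) (by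
      refine Submodule.span_le.2 ?_
      rintro _ ⟨w, r, y, rfl⟩
      refine Submodule.subset_span ⟨w, r, f.hom y, ?_⟩
      simp))
  map_id Y := ModuleCat.hom_ext (Submodule.linearMap_qext _ (TensorProduct.ext' fun _ _ => rfl))
  map_comp f g :=
    ModuleCat.hom_ext (Submodule.linearMap_qext _ (TensorProduct.ext' fun _ _ => rfl))

instance : (tensorFunctor k R W).Additive where
  map_add {_ Z f g} := ModuleCat.hom_ext (Submodule.linearMap_qext _ (TensorProduct.ext' fun w y =>
    congrArg (Submodule.Quotient.mk (p := balancedRelations k R W Z))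
      (TensorProduct.tmul_add w (f.hom y) (g.hom y))))

/-- `Tor_n^R(Y, W)` for a left `R`-module `Y` and a right `R`-module `W`: the `n`-th left derived
functor of `W ⊗_R -` at `Y`. -/
noncomputable def Tor (Y : Type u) [AddCommGroup Y] [Module R Y] (n : ℕ) : ModuleCat.{u} k :=
  ((tensorFunctor k R W).leftDerived n).obj (ModuleCat.of R Y)

end Tor

/-! ### Auxiliary facts on tensor products and alternating sums -/

section Auxiliary

variable {k A M P : Type*} [Field k] [AddCommGroup A] [Module k A]
  [AddCommGroup M] [Module k M] [AddCommGroup P] [Module k P]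

theorem tensor_ext2 {f g : A ⊗[k] (A ⊗[k] M) →ₗ[k] P}
    (h : ∀ a a' m, f (a ⊗ₜ (a' ⊗ₜ m)) = g (a ⊗ₜ (a' ⊗ₜ m))) : f = g :=
  TensorProduct.ext (LinearMap.ext fun a => TensorProduct.ext' fun a' m => h a a' m)

theorem tensor_ext3 {f g : A ⊗[k] (A ⊗[k] (A ⊗[k] M)) →ₗ[k] P}
    (h : ∀ a a' a'' m, f (a ⊗ₜ (a' ⊗ₜ (a'' ⊗ₜ m))) = g (a ⊗ₜ (a' ⊗ₜ (a'' ⊗ₜ m)))) : f = g :=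
  TensorProduct.ext (LinearMap.ext fun a => tensor_ext2 fun a' a'' m => h a a' a'' m)

theorem alternating_comp {Q : Type*} [AddCommGroup Q] [Module k Q] (n : ℕ)
    (δ : Fin (n + 2) → (M →ₗ[k] P)) (δ' : Fin (n + 3) → (Q →ₗ[k] M))
    (h : ∀ i j : Fin (n + 2), i ≤ j → δ i ∘ₗ δ' j.succ = δ j ∘ₗ δ' i.castSucc) :
    (∑ i : Fin (n + 2), (-1 : k) ^ (i : ℕ) • δ i) ∘ₗ
      (∑ j : Fin (n + 3), (-1 : k) ^ (j : ℕ) • δ' j) = 0 := by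
  have h0 : (∑ i : Fin (n + 2), (-1 : k) ^ (i : ℕ) • δ i) ∘ₗ
      (∑ j : Fin (n + 3), (-1 : k) ^ (j : ℕ) • δ' j) =
      ∑ ij : Fin (n + 2) × Fin (n + 3),
        ((-1 : k) ^ ((ij.1 : ℕ) + (ij.2 : ℕ))) • (δ ij.1 ∘ₗ δ' ij.2) := by
    rw [Fintype.sum_prod_type]
    ext x
    simp only [LinearMap.comp_apply, LinearMap.sum_apply, LinearMap.smul_apply, map_sum, map_smul,
      Finset.smul_sum, smul_smul, pow_add]
    rw [Finset.sum_comm]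
    refine Finset.sum_congr rfl fun i _ => Finset.sum_congr rfl fun j _ => ?_
    rw [mul_comm]
  rw [h0]
  let S : Finset (Fin (n + 2) × Fin (n + 3)) :=
    Finset.univ.filter fun ij => (ij.2 : ℕ) ≤ (ij.1 : ℕ)
  rw [← Finset.sum_add_sum_compl S, ← eq_neg_iff_add_eq_zero, ← Finset.sum_neg_distrib]
  let φ : ∀ ij : Fin (n + 2) × Fin (n + 3), ij ∈ S → Fin (n + 2) × Fin (n + 3) := fun ij hij =>
    (Fin.castLT ij.2 (lt_of_le_of_lt (Finset.mem_filter.mp hij).right (Fin.is_lt ij.1)), ij.1.succ)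
  apply Finset.sum_bij φ
  · intro ij hij
    simp_rw [S, φ, Finset.compl_filter, Finset.mem_filter_univ, Fin.val_succ,
      Fin.val_castLT] at hij ⊢
    lia
  · rintro ⟨i, j⟩ hij ⟨i', j'⟩ hij' h
    rw [Prod.mk_inj]
    exact ⟨by simpa [φ] using! congr_arg Prod.snd h,
      by simpa [φ, Fin.castSucc_castLT] using! congr_arg Fin.castSucc (congr_arg Prod.fst h)⟩
  · rintro ⟨i', j'⟩ hij'
    simp_rw [S, Finset.compl_filter, Finset.mem_filter_univ, not_le] at hij'
    refine ⟨(j'.pred <| ?_, Fin.castSucc i'), ?_, ?_⟩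
    · rintro rfl
      simp only [Fin.val_zero, not_lt_zero] at hij'
    · simpa [S] using! Nat.le_sub_one_of_lt hij'
    · simp only [φ, Fin.castLT_castSucc, Fin.succ_pred]
  · rintro ⟨i, j⟩ hij
    have hij' : (j : ℕ) ≤ (i : ℕ) := (Finset.mem_filter.mp hij).right
    have h1 := h (Fin.castLT j (lt_of_le_of_lt hij' (Fin.is_lt i))) i hij'
    rw [Fin.castSucc_castLT] at h1
    simp only [φ, h1, Fin.val_succ, Fin.val_castLT, ← neg_smul]
    congr 1
    rw [pow_add, pow_add, pow_succ]
    ring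

end Auxiliary

/-! ### The Hopf-Hochschild complex -/

section Complex

variable {k A V : Type u} {B : Type*} [Field k] [Ring B] [Bialgebra k B] [Ring A] [Algebra k A]
  [Module B A] [IsScalarTower k B A] [AddCommGroup V] [Module k V]

/-- The module `CH_n(A, V) = A^{⊗ n} ⊗ V`, as the iterated tensor product
`A ⊗ (A ⊗ ⋯ (A ⊗ V))`. -/
noncomputable def CH (k A V : Type u) [Field k] [Ring A] [Algebra k A] [AddCommGroup V]
    [Module k V] : ℕ → ModuleCat.{u} k
  | 0 => ModuleCat.of k V
  | n + 1 => ModuleCat.of k (A ⊗[k] CH k A V n)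

variable (D : EquivariantStructure k B A V)

/-- The diagonal action `L_b` of `B` on `A^{⊗ n} ⊗ V`. -/
noncomputable def diagAct : (n : ℕ) → B →ₐ[k] Module.End k (CH k A V n)
  | 0 => D.ρ
  | n + 1 => diag (act k B A) (diagAct n)

/-- The faces `CH_{n+1} → CH_n` that multiply two neighbours:
`a₁ ⊗ ⋯ ⊗ a_{n+1} ⊗ v ↦ ⋯ ⊗ a_{j+1} a_{j+2} ⊗ ⋯ ⊗ v` for `0 ≤ j < n`, and
`a₁ ⊗ ⋯ ⊗ a_n ⊗ a_{n+1} v` for `j = n`. -/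
noncomputable def innerFace : (n : ℕ) → Fin (n + 1) → (CH k A V (n + 1) →ₗ[k] CH k A V n)
  | 0 => fun _ => TensorProduct.lift D.l.toLinearMap
  | n + 1 => Fin.cases
      (TensorProduct.lift
        (Algebra.lsmul k k (A ⊗[k] CH k A V n) :
          A →ₐ[k] Module.End k (A ⊗[k] CH k A V n)).toLinearMap)
      (fun j => (innerFace n j).lTensor A)

/-- The map `a ↦ (a₁ ⊗ ⋯ ⊗ a_n ⊗ v ↦ a₁ ⊗ ⋯ ⊗ a_n ⊗ v a)`. -/
noncomputable def rightMul : (n : ℕ) → A →ₗ[k] (CH k A V n →ₗ[k] CH k A V n)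
  | 0 => D.r.toLinearMap ∘ₗ (MulOpposite.opLinearEquiv k).toLinearMap
  | n + 1 => LinearMap.lTensorHom A ∘ₗ rightMul n

/-- The cyclic face `CH_{n+1} → CH_n`, `a₁ ⊗ ⋯ ⊗ a_{n+1} ⊗ v ↦ a₂ ⊗ ⋯ ⊗ a_{n+1} ⊗ v a₁`. -/
noncomputable def cyclicFace (n : ℕ) : CH k A V (n + 1) →ₗ[k] CH k A V n :=
  TensorProduct.lift (rightMul D n)

/-- All faces `CH_{n+1} → CH_n`, the cyclic one being the first. -/
noncomputable def face (n : ℕ) : Fin (n + 2) → (CH k A V (n + 1) →ₗ[k] CH k A V n) :=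
  Fin.cases (cyclicFace D n) (innerFace D n)

/-- The Hochschild differential `CH_{n+1} → CH_n`,
`d(a₁ ⊗ ⋯ ⊗ a_{n+1} ⊗ v) = a₂ ⊗ ⋯ ⊗ a_{n+1} ⊗ v a₁ + ∑_{1 ≤ j ≤ n} (-1)^j ⋯ ⊗ a_j a_{j+1} ⊗ ⋯ ⊗ v
  + (-1)^{n+1} a₁ ⊗ ⋯ ⊗ a_n ⊗ a_{n+1} v`. -/
noncomputable def chD (n : ℕ) : CH k A V (n + 1) →ₗ[k] CH k A V n :=
  ∑ j : Fin (n + 2), (-1 : k) ^ (j : ℕ) • face D n j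

/-- The commutator `[L_b, ∂] = L_b ∂ - ∂ L_b` of the diagonal action of `b` and the cyclic
face `∂`. -/
noncomputable def commutator (n : ℕ) (b : B) : CH k A V (n + 1) →ₗ[k] CH k A V n :=
  diagAct D n b ∘ₗ cyclicFace D n - cyclicFace D n ∘ₗ diagAct D (n + 1) b

/-- The submodule `J_n(A, B, V)` of `CH_n(A, V)`, the sum over `b ∈ B` of the images of the
commutators `[L_b, ∂]`. -/
noncomputable def J (n : ℕ) : Submodule k (CH k A V n) :=
  ⨆ b : B, LinearMap.range (commutator D n b)

theorem innerFace_intertwines [IsModuleAlgebra k B A] (n : ℕ) (j : Fin (n + 1)) :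
    Intertwines (diagAct D (n + 1)) (diagAct D n) (innerFace D n j) := by
  induction n with
  | zero => exact D.left
  | succ n ih =>
    refine Fin.cases ?_ (fun j => ?_) j
    · exact intertwines_mul_left (diagAct D n)
    · exact (ih j).lTensor (act k B A)

theorem innerFace_innerFace (n : ℕ) (i j : Fin (n + 1)) (h : i ≤ j) :
    innerFace D n i ∘ₗ innerFace D (n + 1) j.succ =
      innerFace D n j ∘ₗ innerFace D (n + 1) i.castSucc := by
  induction n with
  | zero =>
    obtain rfl : i = 0 := Fin.fin_one_eq_zero i
    obtain rfl : j = 0 := Fin.fin_one_eq_zero j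
    refine tensor_ext2 fun a a' v => ?_
    change D.l a (D.l a' v) = D.l (a * a') v
    rw [map_mul]
    rfl
  | succ n ih =>
    induction j using Fin.cases with
    | zero =>
      obtain rfl : i = 0 := le_antisymm h (Fin.zero_le _)
      refine tensor_ext3 fun a a' a'' t => ?_
      change (a * (a' * a'')) ⊗ₜ[k] t = ((a * a') * a'') ⊗ₜ[k] t
      rw [mul_assoc]
    | succ j =>
      induction i using Fin.cases with
      | zero => exact tensor_ext2 fun a a' t => rfl
      | succ i =>
        have h1 := ih i j (Fin.succ_le_succ_iff.1 h)
        refine TensorProduct.ext' fun a t => ?_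
        change a ⊗ₜ[k] (innerFace D n i ∘ₗ innerFace D (n + 1) j.succ) t =
          a ⊗ₜ[k] (innerFace D n j ∘ₗ innerFace D (n + 1) i.castSucc) t
        rw [h1]

theorem rightMul_mul (n : ℕ) (a a' : A) :
    rightMul D n (a * a') = rightMul D n a' ∘ₗ rightMul D n a := by
  induction n with
  | zero =>
    refine LinearMap.ext fun v => ?_
    change D.r (MulOpposite.op (a * a')) v = D.r (MulOpposite.op a') (D.r (MulOpposite.op a) v)
    rw [MulOpposite.op_mul, map_mul]
    rfl
  | succ n ih =>
    change (rightMul D n (a * a')).lTensor A =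
      (rightMul D n a').lTensor A ∘ₗ (rightMul D n a).lTensor A
    rw [ih, LinearMap.lTensor_comp]

theorem innerFace_rightMul (n : ℕ) (j : Fin (n + 1)) (a : A) :
    innerFace D n j ∘ₗ rightMul D (n + 1) a = rightMul D n a ∘ₗ innerFace D n j := by
  induction n with
  | zero => exact TensorProduct.ext' fun c v => D.comm c (MulOpposite.op a) v
  | succ n ih =>
    induction j using Fin.cases with
    | zero => exact tensor_ext2 fun c c' t => rfl
    | succ j =>
      change (innerFace D n j).lTensor A ∘ₗ (rightMul D (n + 1) a).lTensor A =
        (rightMul D n a).lTensor A ∘ₗ (innerFace D n j).lTensor A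
      rw [← LinearMap.lTensor_comp, ih, LinearMap.lTensor_comp]

theorem cyclicFace_innerFace_zero (n : ℕ) :
    cyclicFace D n ∘ₗ innerFace D (n + 1) 0 = cyclicFace D n ∘ₗ cyclicFace D (n + 1) :=
  tensor_ext2 fun a a' t => LinearMap.congr_fun (rightMul_mul D n a a') t

theorem cyclicFace_innerFace_succ (n : ℕ) (j : Fin (n + 1)) :
    cyclicFace D n ∘ₗ innerFace D (n + 1) j.succ = innerFace D n j ∘ₗ cyclicFace D (n + 1) :=
  TensorProduct.ext' fun a t => (LinearMap.congr_fun (innerFace_rightMul D n j a) t).symm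

theorem face_face (n : ℕ) (i j : Fin (n + 2)) (h : i ≤ j) :
    face D n i ∘ₗ face D (n + 1) j.succ = face D n j ∘ₗ face D (n + 1) i.castSucc := by
  induction i using Fin.cases with
  | zero =>
    induction j using Fin.cases with
    | zero => exact cyclicFace_innerFace_zero D n
    | succ j => exact cyclicFace_innerFace_succ D n j
  | succ i =>
    induction j using Fin.cases with
    | zero => exact absurd h (by simp)
    | succ j => exact innerFace_innerFace D n i j (Fin.succ_le_succ_iff.1 h)

theorem chD_chD (n : ℕ) : chD D n ∘ₗ chD D (n + 1) = 0 :=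
  alternating_comp n (face D n) (face D (n + 1)) (face_face D n)

theorem chD_eq (n : ℕ) : chD D n = cyclicFace D n -
    ∑ j : Fin (n + 1), (-1 : k) ^ (j : ℕ) • innerFace D n j := by
  rw [chD, Fin.sum_univ_succ, sub_eq_add_neg, ← Finset.sum_neg_distrib]
  congr 1
  · simp [face]
  · refine Finset.sum_congr rfl fun j _ => ?_
    rw [Fin.val_succ, pow_succ, mul_neg_one, neg_smul]
    rfl

theorem diagAct_comp_chD [IsModuleAlgebra k B A] (n : ℕ) (b : B) :
    diagAct D n b ∘ₗ chD D n - chD D n ∘ₗ diagAct D (n + 1) b = commutator D n b := by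
  have h : diagAct D n b ∘ₗ (∑ j : Fin (n + 1), (-1 : k) ^ (j : ℕ) • innerFace D n j) =
      (∑ j : Fin (n + 1), (-1 : k) ^ (j : ℕ) • innerFace D n j) ∘ₗ diagAct D (n + 1) b := by
    refine LinearMap.ext fun t => ?_
    simp only [LinearMap.comp_apply, LinearMap.sum_apply, LinearMap.smul_apply, map_sum, map_smul]
    refine Finset.sum_congr rfl fun j _ => ?_
    exact congrArg _ (innerFace_intertwines D n j b t).symm
  rw [chD_eq, LinearMap.comp_sub, LinearMap.sub_comp, h, commutator]
  abel

theorem chD_comp_commutator [IsModuleAlgebra k B A] (n : ℕ) (b : B) :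
    chD D n ∘ₗ commutator D (n + 1) b = -(commutator D n b ∘ₗ chD D (n + 1)) := by
  have h1 : chD D n ∘ₗ chD D (n + 1) = 0 := chD_chD D n
  refine LinearMap.ext fun t => ?_
  have h2 := fun x => LinearMap.congr_fun h1 x
  simp only [LinearMap.comp_apply, LinearMap.zero_apply] at h2
  rw [← diagAct_comp_chD D n b, ← diagAct_comp_chD D (n + 1) b]
  simp only [LinearMap.comp_apply, LinearMap.sub_apply, LinearMap.neg_apply, map_sub, h2,
    map_zero]
  abel

/-- `J` is a subcomplex. -/
theorem J_le_comap_chD [IsModuleAlgebra k B A] (n : ℕ) :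
    J D (n + 1) ≤ (J D n).comap (chD D n) := by
  refine iSup_le fun b => ?_
  rintro _ ⟨t, rfl⟩
  have h := LinearMap.congr_fun (chD_comp_commutator D n b) t
  rw [Submodule.mem_comap]
  refine (congrArg (· ∈ J D n) h).mpr ?_
  exact (J D n).neg_mem (Submodule.mem_iSup_of_mem b ⟨_, rfl⟩)

/-- `J` is a graded `B`-submodule. -/
theorem J_le_comap_diagAct (n : ℕ) (b : B) : J D n ≤ (J D n).comap (diagAct D n b) := by
  refine iSup_le fun c => ?_
  rintro _ ⟨t, rfl⟩
  have h : diagAct D n b (commutator D n c t) =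
      commutator D n (b * c) t - commutator D n b (diagAct D (n + 1) c t) := by
    simp only [commutator, LinearMap.sub_apply, LinearMap.comp_apply, map_mul, map_sub,
      Module.End.mul_apply]
    abel
  rw [Submodule.mem_comap, h]
  exact (J D n).sub_mem (Submodule.mem_iSup_of_mem _ ⟨_, rfl⟩)
    (Submodule.mem_iSup_of_mem _ ⟨_, rfl⟩)

/-- `QCH_n(A, B, V) = CH_n(A, V) / J_n(A, B, V)`. -/
abbrev QCH (n : ℕ) : Type u := CH k A V n ⧸ J D n

/-- The action of `b ∈ B` on `QCH_n(A, B, V)`. -/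
noncomputable def qAct (n : ℕ) (b : B) : QCH D n →ₗ[k] QCH D n :=
  (J D n).mapQ (J D n) (diagAct D n b) (J_le_comap_diagAct D n b)

/-- The differential of `QCH_*(A, B, V)`. -/
noncomputable def qD [IsModuleAlgebra k B A] (n : ℕ) : QCH D (n + 1) →ₗ[k] QCH D n :=
  (J D (n + 1)).mapQ (J D n) (chD D n) (J_le_comap_chD D n)

theorem qD_qD [IsModuleAlgebra k B A] (n : ℕ) : qD D n ∘ₗ qD D (n + 1) = 0 := by
  refine Submodule.linearMap_qext _ (LinearMap.ext fun t => ?_)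
  exact congrArg (Submodule.Quotient.mk (p := J D n)) (LinearMap.congr_fun (chD_chD D n) t)

/-- `QCH_*(A, B, V)` is a differential graded `B`-module. -/
theorem qD_qAct [IsModuleAlgebra k B A] (n : ℕ) (b : B) (t : QCH D (n + 1)) :
    qD D n (qAct D (n + 1) b t) = qAct D n b (qD D n t) := by
  obtain ⟨t, rfl⟩ := Submodule.Quotient.mk_surjective _ t
  refine ((Submodule.Quotient.eq (J D n)).2 ?_).symm
  have h := LinearMap.congr_fun (diagAct_comp_chD D n b) t
  exact (congrArg (· ∈ J D n) h).mpr (Submodule.mem_iSup_of_mem b ⟨_, rfl⟩)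

/-- The submodule of `QCH_n(A, B, V)` generated by all `b x - ε(b) x`, so that
`k ⊗_B QCH_n(A, B, V)` is the quotient by it. -/
noncomputable def coinvariantRelations (n : ℕ) : Submodule k (QCH D n) :=
  Submodule.span k {x | ∃ (b : B) (t : QCH D n),
    x = qAct D n b t - Coalgebra.counit (R := k) b • t}

/-- `k ⊗_B QCH_n(A, B, V)`. -/
abbrev BQCH (n : ℕ) : Type u := QCH D n ⧸ coinvariantRelations D n

/-- The differential of `k ⊗_B QCH_*(A, B, V)`. -/
noncomputable def bqD [IsModuleAlgebra k B A] (n : ℕ) : BQCH D (n + 1) →ₗ[k] BQCH D n :=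
  (coinvariantRelations D (n + 1)).mapQ (coinvariantRelations D n) (qD D n) (by
    refine Submodule.span_le.2 ?_
    rintro _ ⟨b, t, rfl⟩
    refine Submodule.subset_span ⟨b, qD D n t, ?_⟩
    rw [map_sub, map_smul, qD_qAct])

theorem bqD_bqD [IsModuleAlgebra k B A] (n : ℕ) : bqD D n ∘ₗ bqD D (n + 1) = 0 := by
  refine Submodule.linearMap_qext _ (LinearMap.ext fun t => ?_)
  exact congrArg (Submodule.Quotient.mk (p := coinvariantRelations D n))
    (LinearMap.congr_fun (qD_qD D n) t)

/-- The Hopf-Hochschild complex `k ⊗_B QCH_*(A, B, V)`. -/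
noncomputable def hopfHochschildComplex [IsModuleAlgebra k B A] :
    ChainComplex (ModuleCat.{u} k) ℕ :=
  ChainComplex.of (fun n => ModuleCat.of k (BQCH D n)) (fun n => ModuleCat.ofHom (bqD D n))
    (fun n => ModuleCat.hom_ext (bqD_bqD D n))

end Complex

/-- The Hopf-Hochschild homology `HH_n^{Hopf}(A, V)` of a `B`-module algebra `A` with coefficients
in a `B`-equivariant `A`-bimodule `V`. -/
noncomputable def HH (k : Type u) (B : Type*) (A V : Type u) [Field k] [Ring B] [Bialgebra k B]
    [Ring A] [Algebra k A] [Module B A] [IsScalarTower k B A] [IsModuleAlgebra k B A]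
    [AddCommGroup V] [Module k V] [Module A V] [IsScalarTower k A V]
    [Module Aᵐᵒᵖ V] [IsScalarTower k Aᵐᵒᵖ V] [SMulCommClass A Aᵐᵒᵖ V]
    [Module B V] [IsScalarTower k B V] [IsEquivariantBimodule k B A V] (n : ℕ) :
    ModuleCat.{u} k :=
  (hopfHochschildComplex (EquivariantStructure.of k B A V)).homology n

end HopfHochschild

/-! Write R for the crossed product Aᵉ ⋊ B. The bar complex P_n = A^{⊗(n+3)}, which is `CH k A A (n
+ 2)`, resolves Ω(A) by projective R-modules, and Vᵒᵖ ⊗_R P_n is k ⊗_B QCH_{n+1}, compatibly with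
differentials. Hence Tor_n is H_{n+1} as soon as both neighbours of P_n are present, that is for n ≥
1.

The identification in each degree (`tensorBarEquiv`). A k-linear map out of Vᵒᵖ ⊗_R Y is a map f on
Y ⊗ V with f(ry ⊗ v) = f(y ⊗ v·r). This uses only the generators and relations of Vᵒᵖ, not that the
formula for v·r is an action. For r = b in B the antipode identities turn the condition f(by ⊗ v) =
f(y ⊗ S(b)v) into invariance of f under the diagonal action (`Coinvariant.antipode`,
`coinvariant_of_antipode`). For Y = A^{⊗(n+2)} the conditions for the two copies of A move the outer
factors onto v, so f is determined by q(a₁ ⊗ ⋯ ⊗ a_n ⊗ v) = f((1 ⊗ a₁ ⊗ ⋯ ⊗ a_n ⊗ 1) ⊗ v).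
Invariance of f becomes invariance of q∂ and, taking the first factor to be 1, of q. These are
exactly the conditions for q to factor through k ⊗_B QCH_n: once q is invariant, it kills all [L_b,
∂] if and only if q∂ is invariant. The bar face a₀a₁ becomes the cyclic face and the other bar faces
become the inner faces, so the differentials agree (`barToBQCH_barD`).

Projectivity (`projective_CH`). The module A^{⊗(n+3)} is induced from the B-module A^{⊗(n+1)} = A ⊗
N: B-maps out of the latter extend to R-maps. Equivariant maps A ⊗ N → Y are B-maps A → Hom(N, Y),
and Hom(N, -) preserves surjections over a field, so lifting for A gives lifting for A ⊗ N
(`Intertwines.exists_lift`). The module A ⊗ A is induced from the trivial module k, to which this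
argument does not apply; hence the resolution starts at A^{⊗3} and resolves Ω(A) instead of A.
Exactness comes from the homotopy t ↦ 1 ⊗ t. -/

namespace HopfHochschild

/-! ### Equivariant structures on `A^{⊗ n} ⊗ V` -/

section CHStructure

/-- `A ⊗ Y` for an equivariant bimodule `Y`, with the outer bimodule structure and the diagonal
action of `B`. -/
noncomputable def EquivariantStructure.tensorLeft {k B A : Type*} [Field k] [Ring B]
    [Bialgebra k B] [Ring A] [Algebra k A] [Module B A] [IsScalarTower k B A]
    [IsModuleAlgebra k B A] {Y : Type*} [AddCommGroup Y] [Module k Y]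
    (D : EquivariantStructure k B A Y) : EquivariantStructure k B A (A ⊗[k] Y) where
  ρ := diag (act k B A) D.ρ
  l := Algebra.lsmul k k (A ⊗[k] Y)
  r := (Module.End.lTensorAlgHom k Y A).comp D.r
  comm a a' t := by
    induction t with
    | zero => simp
    | add x y hx hy => simp only [map_add, hx, hy]
    | tmul x y => rfl
  left := intertwines_mul_left _
  right := intertwines_right_lTensor _ _ _ D.right

variable {k A V : Type u} {B : Type*} [Field k] [Ring B] [Bialgebra k B] [Ring A] [Algebra k A]
  [Module B A] [IsScalarTower k B A] [IsModuleAlgebra k B A] [AddCommGroup V] [Module k V]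
  (D : EquivariantStructure k B A V)

/-- `A^{⊗ n} ⊗ V` as an equivariant bimodule with the outer actions of `A`. -/
noncomputable def CHStructure : (n : ℕ) → EquivariantStructure k B A (CH k A V n)
  | 0 => D
  | n + 1 => (CHStructure n).tensorLeft

theorem CHStructure_rho (n : ℕ) : (CHStructure D n).ρ = diagAct D n := by
  induction n with
  | zero => rfl
  | succ n ih =>
    change diag (act k B A) (CHStructure D n).ρ = diag (act k B A) (diagAct D n)
    rw [ih]

theorem CHStructure_r (n : ℕ) (a : A) :
    (CHStructure D n).r (MulOpposite.op a) = rightMul D n a := by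
  induction n with
  | zero => rfl
  | succ n ih =>
    change ((CHStructure D n).r (MulOpposite.op a)).lTensor A = (rightMul D n a).lTensor A
    rw [ih]

end CHStructure

/-! ### Comparison of `A^{⊗ n} ⊗ A ⊗ V` with `A^{⊗ n} ⊗ V` -/

section Kappa

variable {k A V : Type u} {B : Type*} [Field k] [Ring B] [Bialgebra k B] [Ring A] [Algebra k A]
  [Module B A] [IsScalarTower k B A] [AddCommGroup V] [Module k V]
  (D : EquivariantStructure k B A V)

/-- The map `(a₁ ⊗ ⋯ ⊗ a_n ⊗ a) ⊗ v ↦ a₁ ⊗ ⋯ ⊗ a_n ⊗ a v`. -/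
noncomputable def kappa : (n : ℕ) → (CH k A A n ⊗[k] V →ₗ[k] CH k A V n)
  | 0 => TensorProduct.lift D.l.toLinearMap
  | n + 1 => (kappa n).lTensor A ∘ₗ (TensorProduct.assoc k A (CH k A A n) V).toLinearMap

variable (k A V) in
/-- The map `a₁ ⊗ ⋯ ⊗ a_n ⊗ v ↦ (a₁ ⊗ ⋯ ⊗ a_n ⊗ 1) ⊗ v`. -/
noncomputable def kappaSection : (n : ℕ) → (CH k A V n →ₗ[k] CH k A A n ⊗[k] V)
  | 0 => TensorProduct.mk k A V 1
  | n + 1 => (TensorProduct.assoc k A (CH k A A n) V).symm.toLinearMap ∘ₗ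
      (kappaSection n).lTensor A

theorem kappa_succ_assoc_symm (n : ℕ) (a : A) (x : CH k A A n ⊗[k] V) :
    kappa D (n + 1) ((TensorProduct.assoc k A (CH k A A n) V).symm (a ⊗ₜ x)) =
      a ⊗ₜ[k] kappa D n x := by
  change (kappa D n).lTensor A (TensorProduct.assoc k A (CH k A A n) V
    ((TensorProduct.assoc k A (CH k A A n) V).symm (a ⊗ₜ x))) = _
  rw [LinearEquiv.apply_symm_apply]
  rfl

theorem kappaSection_succ_tmul (n : ℕ) (a : A) (t : CH k A V n) :
    kappaSection k A V (n + 1) (a ⊗ₜ[k] t : A ⊗[k] CH k A V n) =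
      (TensorProduct.assoc k A (CH k A A n) V).symm (a ⊗ₜ kappaSection k A V n t) := rfl

theorem kappa_kappaSection (n : ℕ) (t : CH k A V n) :
    kappa D n (kappaSection k A V n t) = t := by
  induction n with
  | zero =>
    change D.l 1 t = t
    rw [map_one]
    rfl
  | succ n ih =>
    refine TensorProduct.induction_on (motive := fun t : A ⊗[k] CH k A V n =>
      kappa D (n + 1) (kappaSection k A V (n + 1) t) = t) t ?_ (fun a t => ?_) (fun x y hx hy => ?_)
    · exact (congrArg _ (map_zero _)).trans (map_zero _)
    · rw [kappaSection_succ_tmul, kappa_succ_assoc_symm, ih]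
    · exact (congrArg _ (map_add _ x y)).trans ((map_add _ _ _).trans (congrArg₂ _ hx hy))

/-- Associativity (a'a)v = a'(av) in the last factor: `kappa` is balanced over A. -/
theorem kappa_rightMul [IsModuleAlgebra k B A] (n : ℕ) (a : A) (v : V) :
    kappa D n ∘ₗ (TensorProduct.mk k (CH k A A n) V).flip v ∘ₗ
        rightMul (EquivariantStructure.of k B A A) n a =
      kappa D n ∘ₗ (TensorProduct.mk k (CH k A A n) V).flip (D.l a v) := by
  induction n with
  | zero =>
    refine LinearMap.ext fun (a' : A) => ?_
    change D.l (a' * a) v = D.l a' (D.l a v)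
    rw [map_mul]
    rfl
  | succ n ih =>
    refine TensorProduct.ext' fun a' t => ?_
    change a' ⊗ₜ[k] _ = a' ⊗ₜ[k] _
    exact congrArg _ (LinearMap.congr_fun ih t)

theorem rightMul_kappa (n : ℕ) (a : A) :
    rightMul D n a ∘ₗ kappa D n =
      kappa D n ∘ₗ (D.r (MulOpposite.op a)).lTensor (CH k A A n) := by
  induction n with
  | zero => exact TensorProduct.ext' fun a' v => (D.comm a' (MulOpposite.op a) v).symm
  | succ n ih =>
    refine TensorProduct.ext_threefold fun a' t v => ?_
    change a' ⊗ₜ[k] _ = a' ⊗ₜ[k] _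
    exact congrArg _ (LinearMap.congr_fun ih (t ⊗ₜ v))

theorem kappaSection_rightMul (n : ℕ) (a : A) :
    kappaSection k A V n ∘ₗ rightMul D n a =
      (D.r (MulOpposite.op a)).lTensor (CH k A A n) ∘ₗ kappaSection k A V n := by
  induction n with
  | zero => rfl
  | succ n ih =>
    refine TensorProduct.ext' fun a' t => ?_
    change (TensorProduct.assoc k A (CH k A A n) V).symm
      (a' ⊗ₜ (kappaSection k A V n ∘ₗ rightMul D n a) t) =
      (D.r (MulOpposite.op a)).lTensor (A ⊗[k] CH k A A n)
        ((TensorProduct.assoc k A (CH k A A n) V).symm (a' ⊗ₜ kappaSection k A V n t))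
    rw [ih, LinearMap.comp_apply]
    generalize kappaSection k A V n t = x
    induction x with
    | zero => simp
    | add x y hx hy => simp only [map_add, TensorProduct.tmul_add, hx, hy]
    | tmul x y => rfl

/-- The only face touching the last factor is the last one, where (a a')v = a(a'v) turns a product
in A into the action on V. -/
theorem kappa_innerFace [IsModuleAlgebra k B A] (n : ℕ) (j : Fin (n + 1)) :
    kappa D n ∘ₗ (innerFace (EquivariantStructure.of k B A A) n j).rTensor V =
      innerFace D n j ∘ₗ kappa D (n + 1) := by
  induction n with
  | zero =>
    refine TensorProduct.ext_threefold fun a (a' : A) v => ?_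
    change D.l (a * a') v = D.l a (D.l a' v)
    rw [map_mul]
    rfl
  | succ n ih =>
    refine TensorProduct.ext_threefold fun a t v => ?_
    induction j using Fin.cases with
    | zero =>
      have h : (kappa D (n + 1) ∘ₗ
            (innerFace (EquivariantStructure.of k B A A) (n + 1) 0).rTensor V) ∘ₗ
            (TensorProduct.mk k (A ⊗[k] CH k A A (n + 1)) V).flip v ∘ₗ TensorProduct.mk k A _ a =
          (innerFace D (n + 1) 0 ∘ₗ kappa D (n + 2)) ∘ₗ
            (TensorProduct.mk k (A ⊗[k] CH k A A (n + 1)) V).flip v ∘ₗ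
              TensorProduct.mk k A _ a :=
        TensorProduct.ext' fun a' t => rfl
      exact LinearMap.congr_fun h t
    | succ j =>
      change a ⊗ₜ[k] _ = a ⊗ₜ[k] _
      exact congrArg _ (LinearMap.congr_fun (ih j) (t ⊗ₜ v))

theorem kappa_intertwines [IsModuleAlgebra k B A] (n : ℕ) :
    Intertwines (diag (diagAct (EquivariantStructure.of k B A A) n) D.ρ) (diagAct D n)
      (kappa D n) := by
  induction n with
  | zero => exact D.left
  | succ n ih => exact (ih.lTensor (act k B A)).comp (intertwines_assoc _ _ _)

/-- Inserting the unit is equivariant because b(1) = ε(b)1. -/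
theorem kappaSection_intertwines [IsModuleAlgebra k B A] (n : ℕ) :
    Intertwines (diagAct D n) (diag (diagAct (EquivariantStructure.of k B A A) n) D.ρ)
      (kappaSection k A V n) := by
  induction n with
  | zero => exact fun b v => (diag_one_left (A := A) D.ρ b v).symm
  | succ n ih => exact (intertwines_assoc_symm _ _ _).comp (ih.lTensor (act k B A))

/-- A map that is balanced over `A` is determined by its values on `a₁ ⊗ ⋯ ⊗ a_n ⊗ 1 ⊗ v`. -/
theorem comp_kappaSection_comp_kappa [IsModuleAlgebra k B A] {Q : Type*} [AddCommGroup Q]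
    [Module k Q] (n : ℕ) (g : CH k A A n ⊗[k] V →ₗ[k] Q)
    (hg : ∀ a t v, g (rightMul (EquivariantStructure.of k B A A) n a t ⊗ₜ v) =
      g (t ⊗ₜ D.l a v)) (x : CH k A A n ⊗[k] V) :
    g (kappaSection k A V n (kappa D n x)) = g x := by
  suffices h : g ∘ₗ kappaSection k A V n ∘ₗ kappa D n = g from LinearMap.congr_fun h x
  clear x
  induction n with
  | zero =>
    refine TensorProduct.ext' fun (a : A) v => ?_
    change g ((1 : A) ⊗ₜ D.l a v) = g (a ⊗ₜ v)
    refine (hg a (1 : A) v).symm.trans ?_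
    change g (((1 : A) * a) ⊗ₜ v) = _
    rw [one_mul]
  | succ n ih =>
    refine TensorProduct.ext_threefold fun a t v => ?_
    -- The first factor is frozen at `a`: the balancing concerns the innermost factor only, so the
    -- restricted map is still balanced.
    have h := ih (g ∘ₗ (TensorProduct.assoc k A (CH k A A n) V).symm.toLinearMap ∘ₗ
      TensorProduct.mk k A _ a) (fun a' t v => hg a' (a ⊗ₜ[k] t : A ⊗[k] CH k A A n) v)
    exact LinearMap.congr_fun h (t ⊗ₜ v)

end Kappa

/-! ### Coinvariant maps and the antipode -/

section Coinvariant

variable {k B : Type*} [Field k] [Ring B]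
variable {Y V Q : Type*} [AddCommGroup Y] [Module k Y] [AddCommGroup V] [Module k V]
  [AddCommGroup Q] [Module k Q]

/-- `f` is invariant under the action `ρ`: `f (b y) = ε(b) f (y)`. -/
def Coinvariant [Bialgebra k B] (ρ : B →ₐ[k] Module.End k Y) (f : Y →ₗ[k] Q) : Prop :=
  ∀ (b : B) (y : Y), f (ρ b y) = Coalgebra.counit (R := k) b • f y

theorem Coinvariant.comp [Bialgebra k B] {ρ : B →ₐ[k] Module.End k Y} {σ : B →ₐ[k] Module.End k V}
    {f : Y →ₗ[k] Q} {g : V →ₗ[k] Y} (hf : Coinvariant ρ f) (hg : Intertwines σ ρ g) :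
    Coinvariant σ (f ∘ₗ g) := by
  intro b v
  rw [LinearMap.comp_apply, hg, hf, LinearMap.comp_apply]

/-- A map on `Y ⊗ V` that is invariant under the diagonal action satisfies
`f (b y ⊗ v) = f (y ⊗ S(b) v)`. -/
theorem Coinvariant.antipode [HopfAlgebra k B] {ρ : B →ₐ[k] Module.End k Y} {σ : B →ₐ[k] Module.End k V}
    {f : Y ⊗[k] V →ₗ[k] Q} (hf : Coinvariant (diag ρ σ) f) (b : B) (y : Y) (v : V) :
    f (ρ b y ⊗ₜ v) = f (y ⊗ₜ σ (HopfAlgebra.antipode k b) v) := by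
  let φ : B →ₗ[k] Y := ρ.toLinearMap.flip y
  let ψ : B →ₗ[k] V := σ.toLinearMap.flip v
  -- The value of `H` on the iterated coproduct is ∑ f(b₍₁₎y ⊗ b₍₂₎S(b₍₃₎)v), computed twice.
  -- Contracting the last two legs first leaves f(by ⊗ v); grouping the first two legs as a diagonal
  -- action on y ⊗ S(b₍₃₎)v and using invariance leaves f(y ⊗ S(b)v).
  let H : B ⊗[k] (B ⊗[k] B) →ₗ[k] Q := f ∘ₗ TensorProduct.map φ
    (ψ ∘ₗ LinearMap.mul' k B ∘ₗ (HopfAlgebra.antipode k).lTensor B)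
  have h1 : H ((Coalgebra.comul (R := k)).lTensor B (Coalgebra.comul b)) = f (φ b ⊗ₜ v) := by
    have h : ∀ z : B ⊗[k] B, H ((Coalgebra.comul (R := k)).lTensor B z) =
        f (TensorProduct.map φ (LinearMap.toSpanSingleton k V v)
          ((Coalgebra.counit (R := k)).lTensor B z)) := by
      intro z
      induction z with
      | zero => simp
      | add x y hx hy => simp only [map_add, hx, hy]
      | tmul x c =>
        have h0 := LinearMap.congr_fun (HopfAlgebra.mul_antipode_lTensor_comul (R := k) (A := B)) c
        simp only [LinearMap.comp_apply] at h0
        simp only [H, LinearMap.lTensor_tmul, LinearMap.comp_apply, TensorProduct.map_tmul, h0]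
        simp [ψ, Algebra.algebraMap_eq_smul_one]
    rw [h, Coalgebra.lTensor_counit_comul]
    simp
  have h2 : ∀ z : B ⊗[k] B, H (TensorProduct.assoc k B B B
      ((Coalgebra.comul (R := k)).rTensor B z)) =
      f (y ⊗ₜ ψ (HopfAlgebra.antipode k (TensorProduct.lid k B
        ((Coalgebra.counit (R := k)).rTensor B z)))) := by
    intro z
    induction z with
    | zero => simp
    | add x y hx hy => simp only [map_add, TensorProduct.tmul_add, hx, hy]
    | tmul x c =>
      have h3 : ∀ w : B ⊗[k] B, H (TensorProduct.assoc k B B B (w ⊗ₜ c)) =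
          f (TensorProduct.map φ (σ.toLinearMap.flip (σ (HopfAlgebra.antipode k c) v)) w) := by
        intro w
        induction w with
        | zero => simp
        | add x y hx hy => simp only [map_add, TensorProduct.add_tmul, hx, hy]
        | tmul x y => simp [H, ψ]
      rw [LinearMap.rTensor_tmul, h3, ← diag_tmul, hf]
      simp [ψ]
  have h3 := h2 (Coalgebra.comul b)
  rw [Coalgebra.coassoc_apply, h1, Coalgebra.rTensor_counit_comul] at h3
  simpa [φ, ψ] using h3

/-- Moving b₍₁₎ across gives ∑ f(y ⊗ S(b₍₁₎)b₍₂₎v) = ε(b) f(y ⊗ v). This is the converse of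
`Coinvariant.antipode`. -/
theorem coinvariant_of_antipode [HopfAlgebra k B] {ρ : B →ₐ[k] Module.End k Y} {σ : B →ₐ[k] Module.End k V}
    {f : Y ⊗[k] V →ₗ[k] Q}
    (hf : ∀ (b : B) (y : Y) (v : V), f (ρ b y ⊗ₜ v) = f (y ⊗ₜ σ (HopfAlgebra.antipode k b) v)) :
    Coinvariant (diag ρ σ) f := by
  intro b x
  induction x with
  | zero => simp
  | add x y hx hy => simp only [map_add, smul_add, hx, hy]
  | tmul y v =>
    have h : ∀ z : B ⊗[k] B, f (TensorProduct.map (ρ.toLinearMap.flip y)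
        (σ.toLinearMap.flip v) z) =
        f (y ⊗ₜ σ (LinearMap.mul' k B ((HopfAlgebra.antipode k).rTensor B z)) v) := by
      intro z
      induction z with
      | zero => simp
      | add x y hx hy =>
        simp only [map_add, LinearMap.add_apply, TensorProduct.tmul_add, hx, hy]
      | tmul x c => simp [hf]
    have h0 := LinearMap.congr_fun (HopfAlgebra.mul_antipode_rTensor_comul (R := k) (A := B)) b
    simp only [LinearMap.comp_apply] at h0
    rw [diag_tmul, h, h0]
    simp [Algebra.algebraMap_eq_smul_one]

end Coinvariant

/-! ### The universal property of `k ⊗_B QCH_n` -/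

section BQCH

variable {k A V : Type u} {B : Type*} [Field k] [Ring B] [Bialgebra k B] [Ring A] [Algebra k A]
  [Module B A] [IsScalarTower k B A] [AddCommGroup V] [Module k V]
  (D : EquivariantStructure k B A V)

/-- The projection `CH_n → k ⊗_B QCH_n`. -/
noncomputable def bqMk (n : ℕ) : CH k A V n →ₗ[k] BQCH D n :=
  (coinvariantRelations D n).mkQ ∘ₗ (J D n).mkQ

theorem bqMk_surjective (n : ℕ) : Function.Surjective (bqMk D n) :=
  ((coinvariantRelations D n).mkQ_surjective).comp (J D n).mkQ_surjective

theorem coinvariant_bqMk (n : ℕ) : Coinvariant (diagAct D n) (bqMk D n) := by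
  intro b t
  rw [← map_smul]
  exact (Submodule.Quotient.eq (coinvariantRelations D n)).2
    (Submodule.subset_span ⟨b, (J D n).mkQ t, by rw [map_smul]; rfl⟩)

/-- Dividing by J makes ∂ commute with L_b, so invariance of the projection passes to its composite
with ∂. -/
theorem coinvariant_bqMk_comp_cyclicFace (n : ℕ) :
    Coinvariant (diagAct D (n + 1)) (bqMk D n ∘ₗ cyclicFace D n) := by
  intro b t
  have h : (J D n).mkQ (commutator D n b t) = 0 :=
    (Submodule.Quotient.mk_eq_zero _).2 (Submodule.mem_iSup_of_mem b ⟨t, rfl⟩)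
  have h1 : bqMk D n (commutator D n b t) = 0 := by
    rw [bqMk, LinearMap.comp_apply, h, map_zero]
  rw [commutator, LinearMap.sub_apply, map_sub, sub_eq_zero] at h1
  exact h1.symm.trans (coinvariant_bqMk D n b (cyclicFace D n t))

/-- A map on `CH_n` that is invariant, and whose composition with the cyclic face is invariant,
descends to `k ⊗_B QCH_n`. -/
noncomputable def bqLift {Q : Type*} [AddCommGroup Q] [Module k Q] (n : ℕ)
    (q : CH k A V n →ₗ[k] Q) (h : Coinvariant (diagAct D n) q)
    (h' : Coinvariant (diagAct D (n + 1)) (q ∘ₗ cyclicFace D n)) : BQCH D n →ₗ[k] Q :=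
  (coinvariantRelations D n).liftQ
    ((J D n).liftQ q (iSup_le fun b => by
      rintro _ ⟨t, rfl⟩
      rw [LinearMap.mem_ker, commutator, LinearMap.sub_apply, map_sub, sub_eq_zero]
      -- Both q L_b ∂ and q ∂ L_b equal ε(b) q ∂, so q kills the commutator.
      exact (h b _).trans (h' b t).symm))
    (Submodule.span_le.2 (by
      rintro _ ⟨b, t, rfl⟩
      obtain ⟨t, rfl⟩ := Submodule.Quotient.mk_surjective _ t
      rw [SetLike.mem_coe, LinearMap.mem_ker, map_sub, map_smul, sub_eq_zero]
      exact h b t))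

theorem bqLift_bqMk {Q : Type*} [AddCommGroup Q] [Module k Q] (n : ℕ)
    (q : CH k A V n →ₗ[k] Q) (h : Coinvariant (diagAct D n) q)
    (h' : Coinvariant (diagAct D (n + 1)) (q ∘ₗ cyclicFace D n)) (t : CH k A V n) :
    bqLift D n q h h' (bqMk D n t) = q t := rfl

end BQCH

/-! ### The universal property of the tensor product with a generated module -/

section GeneratedTensor

variable {k R V Y : Type*} [Field k] [Ring R] [Algebra k R] [AddCommGroup V] [Module k V]
  (φ : R →ₗ[k] Module.End k V) [AddCommGroup Y] [Module k Y] [Module R Y]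

variable (Y) in
/-- The map `y ⊗ v ↦ [v] ⊗ y` to the tensor product over `R`. -/
noncomputable def Generated.tensorMk : Y ⊗[k] V →ₗ[k]
    (Generated k R φ ⊗[k] Y) ⧸ balancedRelations k R (Generated k R φ) Y :=
  (balancedRelations k R (Generated k R φ) Y).mkQ ∘ₗ
    (Generated.mk k R φ).rTensor Y ∘ₗ (TensorProduct.comm k Y V).toLinearMap

theorem Generated.tensorMk_tmul (y : Y) (v : V) :
    Generated.tensorMk Y φ (y ⊗ₜ v) =
      (balancedRelations k R (Generated k R φ) Y).mkQ (Generated.mk k R φ v ⊗ₜ y) := rfl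

/-- Here r crosses the tensor sign onto [v], where the defining relation [v]r = [φ(r)v] absorbs it.
-/
theorem Generated.tensorMk_smul (r : R) (y : Y) (v : V) :
    Generated.tensorMk Y φ ((r • y) ⊗ₜ v) = Generated.tensorMk Y φ (y ⊗ₜ φ r v) := by
  rw [tensorMk_tmul, tensorMk_tmul, ← Generated.op_smul_mk]
  exact ((Submodule.Quotient.eq (balancedRelations k R (Generated k R φ) Y)).2
    (Submodule.subset_span ⟨_, r, y, rfl⟩)).symm

theorem Generated.induction_on {p : Generated k R φ → Prop} (w : Generated k R φ)
    (smul : ∀ (r : R) (v : V), p (MulOpposite.op r • Generated.mk k R φ v))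
    (add : ∀ w w', p w → p w' → p (w + w')) : p w := by
  obtain ⟨t, rfl⟩ := Submodule.Quotient.mk_surjective (generatedRelations k R φ) w
  induction t with
  | zero =>
    have := smul 0 0
    rw [map_zero, smul_zero] at this
    exact this
  | add x y hx hy => exact add _ _ hx hy
  | tmul r v =>
    have := smul r v
    have h : MulOpposite.op r • (1 : R) ⊗ₜ[k] v = r ⊗ₜ v := by
      change (1 * r) ⊗ₜ[k] v = r ⊗ₜ v
      rw [one_mul]
    rw [← h]
    exact this

theorem Generated.tensorMk_surjective : Function.Surjective (Generated.tensorMk Y φ) := by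
  intro x
  obtain ⟨t, rfl⟩ := Submodule.Quotient.mk_surjective _ x
  induction t with
  | zero => exact ⟨0, map_zero _⟩
  | add x y hx hy =>
    obtain ⟨x', hx⟩ := hx
    obtain ⟨y', hy⟩ := hy
    exact ⟨x' + y', by rw [map_add, hx, hy]; rfl⟩
  | tmul w y =>
    induction w using Generated.induction_on with
    | smul r v =>
      -- From [v]r ⊗ y = [v] ⊗ ry.
      refine ⟨(r • y) ⊗ₜ v, ?_⟩
      rw [tensorMk_tmul]
      exact ((Submodule.Quotient.eq (balancedRelations k R (Generated k R φ) Y)).2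
    (Submodule.subset_span ⟨_, r, y, rfl⟩)).symm
    | add w w' hw hw' =>
      obtain ⟨x', hx⟩ := hw
      obtain ⟨y', hy⟩ := hw'
      exact ⟨x' + y', by rw [map_add, hx, hy, TensorProduct.add_tmul]; rfl⟩

variable [IsScalarTower k R Y] {Q : Type*} [AddCommGroup Q] [Module k Q]

/-- The map `r ⊗ v ↦ (y ↦ f (r y ⊗ v))`. -/
noncomputable def Generated.preLift (f : Y ⊗[k] V →ₗ[k] Q) : R ⊗[k] V →ₗ[k] Y →ₗ[k] Q :=
  TensorProduct.lift (LinearMap.mk₂ k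
    (fun (r : R) (v : V) => f ∘ₗ (TensorProduct.mk k Y V).flip v ∘ₗ Algebra.lsmul k k Y r)
    (fun r s v => by ext y; simp)
    (fun c r v => by ext y; simp [← TensorProduct.smul_tmul'])
    (fun r v w => by ext y; simp)
    (fun c r v => by ext y; simp))

theorem Generated.preLift_tmul (f : Y ⊗[k] V →ₗ[k] Q) (r : R) (v : V) (y : Y) :
    Generated.preLift f (r ⊗ₜ v) y = f ((r • y) ⊗ₜ v) := rfl

/-- Associativity (rs)y = r(sy). It is used twice: to descend to `Generated`, and to see that the
descended map is balanced. -/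
theorem Generated.preLift_op_smul (f : Y ⊗[k] V →ₗ[k] Q) (s : R) (t : R ⊗[k] V) (y : Y) :
    Generated.preLift f (MulOpposite.op s • t) y = Generated.preLift f t (s • y) := by
  induction t with
  | zero => simp
  | add t u ht hu => simp only [smul_add, map_add, LinearMap.add_apply, ht, hu]
  | tmul r v =>
    change Generated.preLift f ((r * s) ⊗ₜ v) y = _
    rw [preLift_tmul, preLift_tmul, mul_smul]

/-- The map `[v] r ↦ (y ↦ f (r y ⊗ v))`. -/
noncomputable def Generated.lift (f : Y ⊗[k] V →ₗ[k] Q)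
    (hf : ∀ (r : R) (y : Y) (v : V), f ((r • y) ⊗ₜ v) = f (y ⊗ₜ φ r v)) :
    Generated k R φ →ₗ[k] Y →ₗ[k] Q :=
  ((generatedRelations k R φ).restrictScalars k).liftQ (Generated.preLift f) (by
      intro t ht
      rw [LinearMap.mem_ker]
      refine Submodule.span_induction (p := fun t _ => Generated.preLift f t = 0)
        ?_ (map_zero _) (fun x y _ _ hx hy => by rw [map_add, hx, hy, add_zero]) ?_ ht
      · rintro _ ⟨r, v, rfl⟩
        ext y
        rw [map_sub, LinearMap.sub_apply, preLift_tmul, preLift_tmul, one_smul, hf, sub_self,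
          LinearMap.zero_apply]
      -- The relations span a right R-submodule while the map is only k-linear, so stability under R
      -- is checked by hand: s moves onto the argument y.
      · intro s x _ hx
        ext y
        have := preLift_op_smul f s.unop x y
        rw [MulOpposite.op_unop, hx] at this
        exact this) ∘ₗ
    (Submodule.Quotient.restrictScalarsEquiv k (generatedRelations k R φ)).symm.toLinearMap

/-- A balanced map on `Y ⊗ V` descends to the tensor product over `R` of `Y` with the module
generated by `V`. -/
noncomputable def Generated.tensorLift (f : Y ⊗[k] V →ₗ[k] Q)
    (hf : ∀ (r : R) (y : Y) (v : V), f ((r • y) ⊗ₜ v) = f (y ⊗ₜ φ r v)) :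
    ((Generated k R φ ⊗[k] Y) ⧸ balancedRelations k R (Generated k R φ) Y) →ₗ[k] Q :=
  (balancedRelations k R (Generated k R φ) Y).liftQ (TensorProduct.lift (Generated.lift φ f hf))
    (Submodule.span_le.2 (by
      rintro _ ⟨w, r, y, rfl⟩
      obtain ⟨t, rfl⟩ := Submodule.Quotient.mk_surjective (generatedRelations k R φ) w
      rw [SetLike.mem_coe, LinearMap.mem_ker, map_sub, sub_eq_zero]
      exact preLift_op_smul f r t y))

theorem Generated.tensorLift_tensorMk (f : Y ⊗[k] V →ₗ[k] Q)
    (hf : ∀ (r : R) (y : Y) (v : V), f ((r • y) ⊗ₜ v) = f (y ⊗ₜ φ r v)) (x : Y ⊗[k] V) :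
    Generated.tensorLift φ f hf (Generated.tensorMk Y φ x) = f x := by
  induction x with
  | zero => simp only [map_zero]
  | add x y hx hy => simp only [map_add, hx, hy]
  | tmul y v =>
    change f (((1 : R) • y) ⊗ₜ v) = _
    rw [one_smul]

end GeneratedTensor

/-! ### Comparison of the tensor product over the crossed product with the Hopf-Hochschild complex -/

section Comparison

variable {k B A : Type u} [Field k] [Ring B] [HopfAlgebra k B] [Ring A] [Algebra k A]
  [Module B A] [IsScalarTower k B A] [IsModuleAlgebra k B A]

/-- The term `A^{⊗ n} ⊗ A` of the bar complex is a left module over the crossed product. -/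
noncomputable instance (n : ℕ) : Module (CrossedProduct k B A) (CH k A A n) :=
  (CHStructure (EquivariantStructure.of k B A A) n).module

theorem bar_smul_def (n : ℕ) (r : CrossedProduct k B A) (y : CH k A A n) :
    r • y = (CHStructure (EquivariantStructure.of k B A A) n).crossAct r y := rfl

instance (n : ℕ) : IsScalarTower k (CrossedProduct k B A) (CH k A A n) where
  smul_assoc c r y := by
    rw [bar_smul_def, map_smul]
    rfl

theorem bar_mk_smul (n : ℕ) (a a' : A) (b : B) (y : CH k A A n) :
    (CrossedProduct.mk a a' b : CrossedProduct k B A) • y =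
      (CHStructure (EquivariantStructure.of k B A A) n).l a
        (rightMul (EquivariantStructure.of k B A A) n a'
          (diagAct (EquivariantStructure.of k B A A) n b y)) :=
  (EquivariantStructure.crossAct_mk _ a a' b y).trans (by rw [CHStructure_r, CHStructure_rho])

theorem bar_mk_smul_left (n : ℕ) (a : A) (y : CH k A A n) :
    (CrossedProduct.mk a 1 1 : CrossedProduct k B A) • y =
      (CHStructure (EquivariantStructure.of k B A A) n).l a y :=
  (EquivariantStructure.crossAct_mk _ a 1 1 y).trans
    (by rw [MulOpposite.op_one, map_one, map_one]; rfl)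

theorem bar_mk_smul_right (n : ℕ) (a : A) (y : CH k A A n) :
    (CrossedProduct.mk 1 a 1 : CrossedProduct k B A) • y =
      rightMul (EquivariantStructure.of k B A A) n a y := by
  rw [bar_mk_smul, map_one, map_one]
  rfl

theorem bar_mk_smul_mid (n : ℕ) (b : B) (y : CH k A A n) :
    (CrossedProduct.mk 1 1 b : CrossedProduct k B A) • y =
      diagAct (EquivariantStructure.of k B A A) n b y :=
  (EquivariantStructure.crossAct_mk _ 1 1 b y).trans
    (by rw [MulOpposite.op_one, map_one, map_one, CHStructure_rho]; rfl)

/-! ### Balanced maps over the crossed product. -/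

variable {V : Type u} [AddCommGroup V] [Module k V] [Module A V] [IsScalarTower k A V]
  [Module Aᵐᵒᵖ V] [IsScalarTower k Aᵐᵒᵖ V]
  [Module B V] [IsScalarTower k B V]
  {Q : Type*} [AddCommGroup Q] [Module k Q]

/-- The element a ⊗ a' ⊗ b acts by b, then a', then a. Peeling these off from the outside sends v to
va, a'va and finally S(b)(a'va), the last move being `Coinvariant.antipode`. -/
theorem balanced_of_coinvariant (n : ℕ) (f : CH k A A n ⊗[k] V →ₗ[k] Q)
    (hf : Coinvariant (diag (diagAct (EquivariantStructure.of k B A A) n) (act k B V)) f)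
    (hl : ∀ (a : A) (y : CH k A A n) (v : V),
      f (((CHStructure (EquivariantStructure.of k B A A) n).l a y : CH k A A n) ⊗ₜ v) =
        f (y ⊗ₜ (MulOpposite.op a • v)))
    (hr : ∀ (a : A) (y : CH k A A n) (v : V),
      f ((rightMul (EquivariantStructure.of k B A A) n a y : CH k A A n) ⊗ₜ v) = f (y ⊗ₜ (a • v)))
    (r : CrossedProduct k B A) (y : CH k A A n) (v : V) :
    f ((r • y) ⊗ₜ v) = f (y ⊗ₜ opAct k B A V r v) := by
  induction r using CrossedProduct.induction_on with
  | zero => simp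
  | add r s hr hs =>
    simp only [add_smul, TensorProduct.add_tmul, map_add, LinearMap.add_apply,
      TensorProduct.tmul_add, hr, hs]
  | mk a a' b =>
    rw [bar_mk_smul, opAct_mk]
    exact (hl a _ v).trans ((hr a' _ _).trans (hf.antipode b y _))

/-- The elements 1 ⊗ 1 ⊗ b give the antipode relation, which implies invariance. The two lemmas
below read off the relations for a ⊗ 1 ⊗ 1 and 1 ⊗ a ⊗ 1, using S(1) = 1; together the three undo
`balanced_of_coinvariant`. -/
theorem coinvariant_of_balanced (n : ℕ) (f : CH k A A n ⊗[k] V →ₗ[k] Q)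
    (hf : ∀ (r : CrossedProduct k B A) (y : CH k A A n) (v : V),
      f ((r • y) ⊗ₜ v) = f (y ⊗ₜ opAct k B A V r v)) :
    Coinvariant (diag (diagAct (EquivariantStructure.of k B A A) n) (act k B V)) f := by
  refine coinvariant_of_antipode fun b (y : CH k A A n) v => ?_
  have h := hf (CrossedProduct.mk 1 1 b) (y : CH k A A n) v
  rw [bar_mk_smul_mid, opAct_mk, MulOpposite.op_one, one_smul, one_smul] at h
  exact h

theorem left_of_balanced (n : ℕ) (f : CH k A A n ⊗[k] V →ₗ[k] Q)
    (hf : ∀ (r : CrossedProduct k B A) (y : CH k A A n) (v : V),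
      f ((r • y) ⊗ₜ v) = f (y ⊗ₜ opAct k B A V r v)) (a : A) (y : CH k A A n) (v : V) :
    f (((CHStructure (EquivariantStructure.of k B A A) n).l a y : CH k A A n) ⊗ₜ v) =
        f (y ⊗ₜ (MulOpposite.op a • v)) := by
  have h := hf (CrossedProduct.mk a 1 1) y v
  rw [bar_mk_smul_left, opAct_mk, HopfAlgebra.antipode_one, one_smul, one_smul] at h
  exact h

theorem right_of_balanced (n : ℕ) (f : CH k A A n ⊗[k] V →ₗ[k] Q)
    (hf : ∀ (r : CrossedProduct k B A) (y : CH k A A n) (v : V),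
      f ((r • y) ⊗ₜ v) = f (y ⊗ₜ opAct k B A V r v)) (a : A) (y : CH k A A n) (v : V) :
    f ((rightMul (EquivariantStructure.of k B A A) n a y : CH k A A n) ⊗ₜ v) =
      f (y ⊗ₜ (a • v)) := by
  have h := hf (CrossedProduct.mk 1 a 1) y v
  rw [bar_mk_smul_right, opAct_mk, HopfAlgebra.antipode_one, one_smul, MulOpposite.op_one,
    one_smul] at h
  exact h

/-! ### The two maps between the bar terms and k ⊗_B QCH. -/

variable (k B A V) [SMulCommClass A Aᵐᵒᵖ V] [IsEquivariantBimodule k B A V]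

/-- The map `A^{⊗ (n + 1)} ⊗ A ⊗ V → k ⊗_B QCH_n`,
`(a₀ ⊗ a₁ ⊗ ⋯ ⊗ a_n ⊗ a) ⊗ v ↦ a₁ ⊗ ⋯ ⊗ a_n ⊗ a v a₀`. -/
noncomputable def barToBQCH (n : ℕ) :
    CH k A A (n + 1) ⊗[k] V →ₗ[k] BQCH (EquivariantStructure.of k B A V) n :=
  bqMk (EquivariantStructure.of k B A V) n ∘ₗ cyclicFace (EquivariantStructure.of k B A V) n ∘ₗ
    kappa (EquivariantStructure.of k B A V) (n + 1)

omit [IsModuleAlgebra k B A] in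
theorem barToBQCH_apply (n : ℕ) (x : CH k A A (n + 1) ⊗[k] V) :
    barToBQCH k B A V n x = bqMk (EquivariantStructure.of k B A V) n
      (cyclicFace (EquivariantStructure.of k B A V) n
        (kappa (EquivariantStructure.of k B A V) (n + 1) x)) := rfl

/-- The cyclic face carries the outer left factor to the right of v, so the claim reduces to v(aa')
= (va)a'. -/
theorem cyclicFace_kappa_left (n : ℕ) (a : A) (v : V) :
    cyclicFace (EquivariantStructure.of k B A V) n ∘ₗ
        kappa (EquivariantStructure.of k B A V) (n + 1) ∘ₗ
        (TensorProduct.mk k (CH k A A (n + 1)) V).flip v ∘ₗ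
        (CHStructure (EquivariantStructure.of k B A A) (n + 1)).l a =
      cyclicFace (EquivariantStructure.of k B A V) n ∘ₗ
        kappa (EquivariantStructure.of k B A V) (n + 1) ∘ₗ
        (TensorProduct.mk k (CH k A A (n + 1)) V).flip (MulOpposite.op a • v) := by
  refine TensorProduct.ext' fun a' t => ?_
  change rightMul (EquivariantStructure.of k B A V) n (a * a')
      (kappa (EquivariantStructure.of k B A V) n (t ⊗ₜ v)) =
    rightMul (EquivariantStructure.of k B A V) n a'
      (kappa (EquivariantStructure.of k B A V) n (t ⊗ₜ (MulOpposite.op a • v)))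
  rw [rightMul_mul, LinearMap.comp_apply]
  exact congrArg _ (LinearMap.congr_fun
    (rightMul_kappa (EquivariantStructure.of k B A V) n a) (t ⊗ₜ v))

/-- This is where the quotient by J is needed: the invariance required for B is that of the
projection composed with ∂. The conditions for A already hold before passing to the quotient. -/
theorem barToBQCH_balanced (n : ℕ) (r : CrossedProduct k B A) (y : CH k A A (n + 1)) (v : V) :
    barToBQCH k B A V n ((r • y) ⊗ₜ v) = barToBQCH k B A V n (y ⊗ₜ opAct k B A V r v) := by
  refine balanced_of_coinvariant (n + 1) _ ?_ (fun a y v => ?_) (fun a y v => ?_) r y v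
  · exact (coinvariant_bqMk_comp_cyclicFace (EquivariantStructure.of k B A V) n).comp
      (kappa_intertwines (EquivariantStructure.of k B A V) (n + 1))
  · exact congrArg (bqMk _ n) (LinearMap.congr_fun (cyclicFace_kappa_left k B A V n a v) y)
  · exact congrArg (bqMk _ n ∘ₗ cyclicFace _ n)
      (LinearMap.congr_fun (kappa_rightMul (EquivariantStructure.of k B A V) (n + 1) a v) y)

variable {k B A V}

/-- The map `CH_n → Q`, `a₁ ⊗ ⋯ ⊗ a_n ⊗ v ↦ f ((1 ⊗ a₁ ⊗ ⋯ ⊗ a_n ⊗ 1) ⊗ v)`. -/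
noncomputable def ofBar (n : ℕ) (f : CH k A A (n + 1) ⊗[k] V →ₗ[k] Q) : CH k A V n →ₗ[k] Q :=
  f ∘ₗ kappaSection k A V (n + 1) ∘ₗ TensorProduct.mk k A (CH k A V n) 1

section

variable (n : ℕ) (f : CH k A A (n + 1) ⊗[k] V →ₗ[k] Q)
  (hf : ∀ (r : CrossedProduct k B A) (y : CH k A A (n + 1)) (v : V),
    f ((r • y) ⊗ₜ v) = f (y ⊗ₜ opAct k B A V r v))

include hf

/-- Inserting 1 at both ends is equivariant, so invariance of f is inherited. -/
theorem coinvariant_ofBar : Coinvariant (diagAct (EquivariantStructure.of k B A V) n)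
    (ofBar n f) :=
  (coinvariant_of_balanced (n + 1) f hf).comp
    ((kappaSection_intertwines (EquivariantStructure.of k B A V) (n + 1)).comp
      fun b t => (diag_one_left _ b t).symm)

/-- The cyclic face followed by the insertion of 1 produces (1 ⊗ ⋯ ⊗ 1) ⊗ va; balancing on the left
moves a back to the first factor. It converts invariance of f into the second condition required by
`bqLift`. -/
theorem ofBar_comp_cyclicFace :
    ofBar n f ∘ₗ cyclicFace (EquivariantStructure.of k B A V) n =
      f ∘ₗ kappaSection k A V (n + 1) := by
  refine TensorProduct.ext' fun a t => ?_
  have h : f ∘ₗ (TensorProduct.assoc k A (CH k A A n) V).symm.toLinearMap ∘ₗ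
      TensorProduct.mk k A _ 1 ∘ₗ
        ((EquivariantStructure.of k B A V).r (MulOpposite.op a)).lTensor (CH k A A n) =
      f ∘ₗ (TensorProduct.assoc k A (CH k A A n) V).symm.toLinearMap ∘ₗ
        TensorProduct.mk k A _ a := by
    refine TensorProduct.ext' fun t v => ?_
    refine (left_of_balanced (n + 1) f hf a ((1 : A) ⊗ₜ[k] t : A ⊗[k] CH k A A n) v).symm.trans ?_
    change f (((a * 1) ⊗ₜ[k] t : A ⊗[k] CH k A A n) ⊗ₜ v) =
      f ((a ⊗ₜ[k] t : A ⊗[k] CH k A A n) ⊗ₜ v)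
    rw [mul_one]
  refine Eq.trans ?_ (LinearMap.congr_fun h (kappaSection k A V n t))
  exact congrArg (fun x => f ((TensorProduct.assoc k A (CH k A A n) V).symm ((1 : A) ⊗ₜ x)))
    (LinearMap.congr_fun (kappaSection_rightMul (EquivariantStructure.of k B A V) n a) t)

theorem coinvariant_ofBar_comp_cyclicFace :
    Coinvariant (diagAct (EquivariantStructure.of k B A V) (n + 1))
      (ofBar n f ∘ₗ cyclicFace (EquivariantStructure.of k B A V) n) := by
  rw [ofBar_comp_cyclicFace n f hf]
  exact (coinvariant_of_balanced (n + 1) f hf).comp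
    (kappaSection_intertwines (EquivariantStructure.of k B A V) (n + 1))

/-- A balanced map is recovered from its values with 1 in both outer positions: left balancing
restores the first factor, right balancing the last. -/
theorem ofBar_cyclicFace_kappa (x : CH k A A (n + 1) ⊗[k] V) :
    ofBar n f (cyclicFace (EquivariantStructure.of k B A V) n
      (kappa (EquivariantStructure.of k B A V) (n + 1) x)) = f x :=
  (LinearMap.congr_fun (ofBar_comp_cyclicFace n f hf) _).trans
    (comp_kappaSection_comp_kappa (EquivariantStructure.of k B A V) (n + 1) f
      (right_of_balanced (n + 1) f hf) x)

end

variable (k B A V) in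
theorem cyclicFace_one_tmul (n : ℕ) (t : CH k A V n) :
    cyclicFace (EquivariantStructure.of k B A V) n ((1 : A) ⊗ₜ[k] t : A ⊗[k] CH k A V n) = t := by
  change rightMul (EquivariantStructure.of k B A V) n 1 t = t
  rw [← CHStructure_r, MulOpposite.op_one, map_one]
  rfl

/-! ### The isomorphism in each degree. -/

variable (k B A V)

/-- `Vᵒᵖ ⊗ A^{⊗ (n + 1)}`, the tensor product being taken over the crossed product. -/
abbrev TensorBar (n : ℕ) : Type u :=
  (Op k B A V ⊗[k] CH k A A n) ⧸
    balancedRelations k (CrossedProduct k B A) (Op k B A V) (CH k A A n)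

/-- The map from `Vᵒᵖ ⊗ A^{⊗ (n + 2)}` to `k ⊗_B QCH_n(A, B, V)`. -/
noncomputable def tensorBarToBQCH (n : ℕ) :
    TensorBar k B A V (n + 1) →ₗ[k] BQCH (EquivariantStructure.of k B A V) n :=
  Generated.tensorLift (opAct k B A V) (barToBQCH k B A V n) (barToBQCH_balanced k B A V n)

theorem tensorBarToBQCH_tensorMk (n : ℕ) (x : CH k A A (n + 1) ⊗[k] V) :
    tensorBarToBQCH k B A V n (Generated.tensorMk _ (opAct k B A V) x) = barToBQCH k B A V n x :=
  Generated.tensorLift_tensorMk _ _ _ _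

/-- The map from `k ⊗_B QCH_n(A, B, V)` to `Vᵒᵖ ⊗ A^{⊗ (n + 2)}`. -/
noncomputable def bqchToTensorBar (n : ℕ) :
    BQCH (EquivariantStructure.of k B A V) n →ₗ[k] TensorBar k B A V (n + 1) :=
  bqLift _ n (ofBar n (Generated.tensorMk (CH k A A (n + 1)) (opAct k B A V)))
      (coinvariant_ofBar n _ (Generated.tensorMk_smul _))
      (coinvariant_ofBar_comp_cyclicFace n _ (Generated.tensorMk_smul _))

theorem bqchToTensorBar_bqMk (n : ℕ) (t : CH k A V n) :
    bqchToTensorBar k B A V n (bqMk _ n t) =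
      ofBar n (Generated.tensorMk (CH k A A (n + 1)) (opAct k B A V)) t :=
  bqLift_bqMk _ n _ _ _ t

theorem barToBQCH_kappaSection (n : ℕ) (t : CH k A V n) :
    barToBQCH k B A V n (kappaSection k A V (n + 1) ((1 : A) ⊗ₜ[k] t : A ⊗[k] CH k A V n)) =
      bqMk _ n t := by
  refine congrArg (bqMk _ n) (Eq.trans ?_ (cyclicFace_one_tmul k B A V n t))
  exact congrArg (cyclicFace _ n)
    (kappa_kappaSection _ (n + 1) ((1 : A) ⊗ₜ[k] t : A ⊗[k] CH k A V n))

theorem bqchToTensorBar_barToBQCH (n : ℕ) (x : CH k A A (n + 1) ⊗[k] V) :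
    bqchToTensorBar k B A V n (barToBQCH k B A V n x) =
      Generated.tensorMk (CH k A A (n + 1)) (opAct k B A V) x := by
  rw [barToBQCH_apply, bqchToTensorBar_bqMk]
  exact ofBar_cyclicFace_kappa n (Generated.tensorMk (CH k A A (n + 1)) (opAct k B A V))
    (Generated.tensorMk_smul (opAct k B A V)) x

/-- The isomorphism between `Vᵒᵖ ⊗ A^{⊗ (n + 2)}` over the crossed product and
`k ⊗_B QCH_n(A, B, V)`. -/
noncomputable def tensorBarEquiv (n : ℕ) :
    TensorBar k B A V (n + 1) ≃ₗ[k] BQCH (EquivariantStructure.of k B A V) n :=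
  LinearEquiv.ofLinearMap (tensorBarToBQCH k B A V n) (bqchToTensorBar k B A V n)
    (by
      refine LinearMap.ext fun x => ?_
      obtain ⟨t, rfl⟩ := bqMk_surjective _ n x
      rw [LinearMap.comp_apply, bqchToTensorBar_bqMk]
      exact (tensorBarToBQCH_tensorMk k B A V n _).trans (barToBQCH_kappaSection k B A V n t))
    (by
      refine LinearMap.ext fun x => ?_
      obtain ⟨t, rfl⟩ := Generated.tensorMk_surjective (opAct k B A V) x
      rw [LinearMap.comp_apply, tensorBarToBQCH_tensorMk, bqchToTensorBar_barToBQCH,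
        LinearMap.id_apply])

theorem tensorBarEquiv_tensorMk (n : ℕ) (x : CH k A A (n + 1) ⊗[k] V) :
    tensorBarEquiv k B A V n (Generated.tensorMk _ (opAct k B A V) x) = barToBQCH k B A V n x :=
  tensorBarToBQCH_tensorMk k B A V n x

/-! ### Compatibility with the differentials. -/

variable {k B A V}

/-- The differential `A^{⊗ (n + 2)} → A^{⊗ (n + 1)}` of the bar complex. -/
noncomputable def barD (D : EquivariantStructure k B A V) (n : ℕ) :
    CH k A V (n + 1) →ₗ[k] CH k A V n :=
  ∑ j : Fin (n + 1), (-1 : k) ^ (j : ℕ) • innerFace D n j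

/-- The bar face a₀a₁ turns v into v(a₀a₁) = (va₀)a₁, which is the cyclic face applied twice; the
later faces do not involve a₀. Thus bar face 0 matches the cyclic face and bar face j + 1 matches
inner face j. -/
theorem cyclicFace_kappa_innerFace (n : ℕ) (j : Fin (n + 2)) :
    cyclicFace (EquivariantStructure.of k B A V) n ∘ₗ
        kappa (EquivariantStructure.of k B A V) (n + 1) ∘ₗ
        (innerFace (EquivariantStructure.of k B A A) (n + 1) j).rTensor V =
      face (EquivariantStructure.of k B A V) n j ∘ₗ
        cyclicFace (EquivariantStructure.of k B A V) (n + 1) ∘ₗ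
        kappa (EquivariantStructure.of k B A V) (n + 2) := by
  rw [kappa_innerFace, ← LinearMap.comp_assoc, ← LinearMap.comp_assoc]
  congr 1
  induction j using Fin.cases with
  | zero => exact cyclicFace_innerFace_zero _ n
  | succ j => exact cyclicFace_innerFace_succ _ n j

/-- Since `face` lists the cyclic face first, faces correspond index by index and the signs agree
without any correction. -/
theorem barToBQCH_barD (n : ℕ) (x : CH k A A (n + 2) ⊗[k] V) :
    barToBQCH k B A V n ((barD (EquivariantStructure.of k B A A) (n + 1)).rTensor V x) =
      bqD (EquivariantStructure.of k B A V) n (barToBQCH k B A V (n + 1) x) := by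
  change bqMk _ n (cyclicFace (EquivariantStructure.of k B A V) n
    (kappa (EquivariantStructure.of k B A V) (n + 1) _)) = bqMk _ n (chD _ n _)
  congr 1
  have h : cyclicFace (EquivariantStructure.of k B A V) n ∘ₗ
        kappa (EquivariantStructure.of k B A V) (n + 1) ∘ₗ
        (barD (EquivariantStructure.of k B A A) (n + 1)).rTensor V =
      chD (EquivariantStructure.of k B A V) n ∘ₗ
        cyclicFace (EquivariantStructure.of k B A V) (n + 1) ∘ₗ
        kappa (EquivariantStructure.of k B A V) (n + 2) := by
    refine TensorProduct.ext' fun y v => ?_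
    simp only [barD, chD, LinearMap.comp_apply, LinearMap.rTensor_tmul, LinearMap.sum_apply,
      LinearMap.smul_apply, TensorProduct.sum_tmul, ← TensorProduct.smul_tmul', map_sum, map_smul]
    exact Finset.sum_congr rfl fun j _ => congrArg _
      (LinearMap.congr_fun (cyclicFace_kappa_innerFace n j) (y ⊗ₜ v))
  exact LinearMap.congr_fun h x

end Comparison

/-! ### Lifting equivariant maps out of `A ⊗ N` for a projective `B`-module `A` -/

section Lifting

variable {k B : Type*} [Field k] [Ring B] [HopfAlgebra k B]
variable {M N Y Z : Type*} [AddCommGroup M] [Module k M] [AddCommGroup N] [Module k N]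
  [AddCommGroup Y] [Module k Y] [AddCommGroup Z] [Module k Z]

/-- `∑ φ(b₍₁₎) ⊗ ψ(b₍₂₎ S(b₍₃₎)) = φ(b) ⊗ ψ(1)`. -/
theorem map_mul_antipode_comul (φ : B →ₗ[k] M) (ψ : B →ₗ[k] N) (b : B) :
    TensorProduct.map φ (ψ ∘ₗ LinearMap.mul' k B ∘ₗ (HopfAlgebra.antipode k).lTensor B)
      (TensorProduct.assoc k B B B
        ((Coalgebra.comul (R := k)).rTensor B (Coalgebra.comul b))) = φ b ⊗ₜ ψ 1 := by
  rw [Coalgebra.coassoc_apply, show (Coalgebra.comul (R := k) (A := B)).lTensor B =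
      TensorProduct.map LinearMap.id Coalgebra.comul from rfl, ← LinearMap.comp_apply,
    ← TensorProduct.map_comp, LinearMap.comp_id,
    LinearMap.comp_assoc, LinearMap.comp_assoc, HopfAlgebra.mul_antipode_lTensor_comul,
    ← LinearMap.comp_assoc, ← LinearMap.comp_id φ, TensorProduct.map_comp, LinearMap.comp_apply,
    LinearMap.comp_id]
  have h := Coalgebra.lTensor_counit_comul (R := k) b
  rw [LinearMap.lTensor] at h
  rw [h]
  simp

/-- `∑ φ(b₍₁₎) ⊗ ψ(S(b₍₂₎) b₍₃₎) = φ(b) ⊗ ψ(1)`. -/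
theorem map_antipode_mul_comul (φ : B →ₗ[k] M) (ψ : B →ₗ[k] N) (b : B) :
    TensorProduct.map φ (ψ ∘ₗ LinearMap.mul' k B ∘ₗ (HopfAlgebra.antipode k).rTensor B)
      (TensorProduct.assoc k B B B
        ((Coalgebra.comul (R := k)).rTensor B (Coalgebra.comul b))) = φ b ⊗ₜ ψ 1 := by
  rw [Coalgebra.coassoc_apply, show (Coalgebra.comul (R := k) (A := B)).lTensor B =
      TensorProduct.map LinearMap.id Coalgebra.comul from rfl, ← LinearMap.comp_apply,
    ← TensorProduct.map_comp, LinearMap.comp_id,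
    LinearMap.comp_assoc, LinearMap.comp_assoc, HopfAlgebra.mul_antipode_rTensor_comul,
    ← LinearMap.comp_assoc, ← LinearMap.comp_id φ, TensorProduct.map_comp, LinearMap.comp_apply,
    LinearMap.comp_id]
  have h := Coalgebra.lTensor_counit_comul (R := k) b
  rw [LinearMap.lTensor] at h
  rw [h]
  simp

variable (τ : B →ₐ[k] Module.End k N) (ρ : B →ₐ[k] Module.End k Y)

variable (N) in
/-- The action of `B` on `Hom(N, Y)` through `Y`. -/
noncomputable def homActLeft : B →ₐ[k] Module.End k (N →ₗ[k] Y) :=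
  AlgHom.ofLinearMap (LinearMap.llcomp k N Y Y ∘ₗ ρ.toLinearMap)
    (by ext u n; simp) (fun b c => by ext u n; simp)

variable (Y) in
/-- The action of `B` on `Hom(N, Y)` through `N` and the antipode. -/
noncomputable def homActRight : B →ₐ[k] Module.End k (N →ₗ[k] Y) :=
  AlgHom.ofLinearMap ((LinearMap.llcomp k N N Y).flip ∘ₗ τ.toLinearMap ∘ₗ
      HopfAlgebra.antipode k)
    -- Precomposition reverses products and so does the antipode; together they give an algebra
    -- morphism.
    (by ext u n; simp) (fun b c => by ext u n; simp [HopfAlgebra.antipode_mul_antidistrib])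

/-- The action of `B` on `Hom(N, Y)`: `(b u)(n) = ∑ b₍₁₎ u(S(b₍₂₎) n)`. -/
noncomputable def homAct : B →ₐ[k] Module.End k (N →ₗ[k] Y) :=
  (Algebra.TensorProduct.lift (homActLeft N ρ) (homActRight Y τ)
    (fun b c => by ext u n; rfl)).comp (Bialgebra.comulAlgHom k B)

theorem homAct_apply (b : B) (u : N →ₗ[k] Y) (n : N) :
    homAct τ ρ b u n = TensorProduct.lift ρ.toLinearMap
      ((u ∘ₗ τ.toLinearMap.flip n ∘ₗ HopfAlgebra.antipode k).lTensor B (Coalgebra.comul b)) := by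
  have h : ∀ z : B ⊗[k] B, Algebra.TensorProduct.lift (homActLeft N ρ) (homActRight Y τ)
      (fun b c => by ext u n; rfl) z u n = TensorProduct.lift ρ.toLinearMap
      ((u ∘ₗ τ.toLinearMap.flip n ∘ₗ HopfAlgebra.antipode k).lTensor B z) := by
    intro z
    induction z with
    | zero => simp
    | add x y hx hy => simp only [map_add, LinearMap.add_apply, hx, hy]
    | tmul x y => simp [homActLeft, homActRight]
  exact h _

theorem Intertwines.homAct_comp {ρ : B →ₐ[k] Module.End k Y} {ρ' : B →ₐ[k] Module.End k Z}
    {g : Y →ₗ[k] Z} (hg : Intertwines ρ ρ' g) (b : B) (u : N →ₗ[k] Y) :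
    g ∘ₗ homAct τ ρ b u = homAct τ ρ' b (g ∘ₗ u) := by
  ext n
  rw [LinearMap.comp_apply, homAct_apply, homAct_apply]
  generalize (Coalgebra.comul (R := k) b) = z
  induction z with
  | zero => simp
  | add x y hx hy => simp only [map_add, hx, hy]
  | tmul x y => simp [hg x]

/-- The adjoint of an equivariant map `M ⊗ N → Y` is an equivariant map `M → Hom(N, Y)`. -/
theorem Intertwines.curry {σ : B →ₐ[k] Module.End k M} {τ : B →ₐ[k] Module.End k N}
    {ρ : B →ₐ[k] Module.End k Y} {h : M ⊗[k] N →ₗ[k] Y} (hh : Intertwines (diag σ τ) ρ h) :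
    Intertwines σ (homAct τ ρ) (TensorProduct.curry h) := by
  intro b m
  ext n
  -- In Sweedler notation: ∑ b₍₁₎h(m ⊗ S(b₍₂₎)n) = ∑ h(b₍₁₎m ⊗ b₍₂₎S(b₍₃₎)n) = h(bm ⊗ n).
  have h1 := map_mul_antipode_comul (σ.toLinearMap.flip m) (τ.toLinearMap.flip n) b
  have h2 : ∀ z : B ⊗[k] B, h (TensorProduct.map (σ.toLinearMap.flip m)
      (τ.toLinearMap.flip n ∘ₗ LinearMap.mul' k B ∘ₗ (HopfAlgebra.antipode k).lTensor B)
      (TensorProduct.assoc k B B B ((Coalgebra.comul (R := k)).rTensor B z))) =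
      TensorProduct.lift ρ.toLinearMap
      ((TensorProduct.curry h m ∘ₗ τ.toLinearMap.flip n ∘ₗ
        HopfAlgebra.antipode k).lTensor B z) := by
    intro z
    induction z with
    | zero => simp
    | add x y hx hy => simp only [map_add, hx, hy]
    | tmul x c =>
      have h3 : ∀ w : B ⊗[k] B, TensorProduct.map (σ.toLinearMap.flip m)
          (τ.toLinearMap.flip n ∘ₗ LinearMap.mul' k B ∘ₗ (HopfAlgebra.antipode k).lTensor B)
          (TensorProduct.assoc k B B B (w ⊗ₜ c)) =
          TensorProduct.map (σ.toLinearMap.flip m)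
            (τ.toLinearMap.flip (τ (HopfAlgebra.antipode k c) n)) w := by
        intro w
        induction w with
        | zero => simp
        | add x y hx hy => simp only [map_add, TensorProduct.add_tmul, hx, hy]
        | tmul x y => simp
      rw [LinearMap.rTensor_tmul, h3, ← diag_tmul, hh]
      simp
  rw [homAct_apply, ← h2, h1]
  simp

/-- An equivariant map `M → Hom(N, Y)` is the adjoint of an equivariant map `M ⊗ N → Y`. -/
theorem Intertwines.uncurry {σ : B →ₐ[k] Module.End k M} {τ : B →ₐ[k] Module.End k N}
    {ρ : B →ₐ[k] Module.End k Y} {F : M →ₗ[k] N →ₗ[k] Y} (hF : Intertwines σ (homAct τ ρ) F) :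
    Intertwines (diag σ τ) ρ (TensorProduct.lift F) := by
  intro b t
  induction t with
  | zero => simp
  | add x y hx hy => simp only [map_add, hx, hy]
  | tmul m n =>
    -- In Sweedler notation: ∑ F(b₍₁₎m)(b₍₂₎n) = ∑ b₍₁₎F(m)(S(b₍₂₎)b₍₃₎n) = bF(m)(n).
    have h1 := congrArg (TensorProduct.lift ρ.toLinearMap)
      (map_antipode_mul_comul LinearMap.id (F m ∘ₗ τ.toLinearMap.flip n) b)
    have h2 : ∀ z : B ⊗[k] B, TensorProduct.lift F (TensorProduct.map (σ.toLinearMap.flip m)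
        (τ.toLinearMap.flip n) z) = TensorProduct.lift ρ.toLinearMap
        (TensorProduct.map LinearMap.id ((F m ∘ₗ τ.toLinearMap.flip n) ∘ₗ LinearMap.mul' k B ∘ₗ
          (HopfAlgebra.antipode k).rTensor B)
          (TensorProduct.assoc k B B B ((Coalgebra.comul (R := k)).rTensor B z))) := by
      intro z
      induction z with
      | zero => simp
      | add x y hx hy => simp only [map_add, hx, hy]
      | tmul x c =>
        have h3 : ∀ w : B ⊗[k] B, TensorProduct.lift ρ.toLinearMap
            (TensorProduct.map LinearMap.id ((F m ∘ₗ τ.toLinearMap.flip n) ∘ₗ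
              LinearMap.mul' k B ∘ₗ (HopfAlgebra.antipode k).rTensor B)
              (TensorProduct.assoc k B B B (w ⊗ₜ c))) =
            TensorProduct.lift ρ.toLinearMap ((F m ∘ₗ τ.toLinearMap.flip (τ c n) ∘ₗ
              HopfAlgebra.antipode k).lTensor B w) := by
          intro w
          induction w with
          | zero => simp
          | add x y hx hy => simp only [map_add, TensorProduct.add_tmul, hx, hy]
          | tmul x y => simp
        rw [LinearMap.rTensor_tmul, h3, ← homAct_apply, ← hF]
        simp
    rw [diag_tmul, h2, h1]
    simp

/-- If `A` is a projective `B`-module, then equivariant maps on `A ⊗ N` lift along surjections. -/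
theorem Intertwines.exists_lift {A : Type*} [AddCommGroup A] [Module k A] [Module B A]
    [IsScalarTower k B A] [Module.Projective B A] {τ : B →ₐ[k] Module.End k N}
    {ρ : B →ₐ[k] Module.End k Y} {ρ' : B →ₐ[k] Module.End k Z} {g : Y →ₗ[k] Z}
    (hg : Intertwines ρ ρ' g) (hs : Function.Surjective g) {h : A ⊗[k] N →ₗ[k] Z}
    (hh : Intertwines (diag (act k B A) τ) ρ' h) :
    ∃ h' : A ⊗[k] N →ₗ[k] Y, Intertwines (diag (act k B A) τ) ρ h' ∧ g ∘ₗ h' = h := by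
  let _ : Module B (N →ₗ[k] Y) := Module.compHom _ (homAct τ ρ).toRingHom
  let _ : Module B (N →ₗ[k] Z) := Module.compHom _ (homAct τ ρ').toRingHom
  have hY : IsScalarTower k B (N →ₗ[k] Y) := ⟨fun c b u => by
    change homAct τ ρ (c • b) u = c • homAct τ ρ b u
    rw [map_smul]
    rfl⟩
  let G : (N →ₗ[k] Y) →ₗ[B] (N →ₗ[k] Z) :=
    { toFun := fun u => g ∘ₗ u
      map_add' := fun u v => LinearMap.comp_add u v g
      map_smul' := fun b u => hg.homAct_comp τ b u }
  have hG : Function.Surjective G := by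
    -- Over a field g has a k-linear section; it need not be equivariant, since only surjectivity of
    -- g ∘ - on Hom(N, -) is needed.
    obtain ⟨s, hs⟩ := g.exists_rightInverse_of_surjective (LinearMap.range_eq_top.2 hs)
    intro u
    refine ⟨s ∘ₗ u, ?_⟩
    change g ∘ₗ s ∘ₗ u = u
    rw [← LinearMap.comp_assoc, hs, LinearMap.id_comp]
  let H : A →ₗ[B] (N →ₗ[k] Z) :=
    { toFun := TensorProduct.curry h
      map_add' := map_add _
      map_smul' := fun b a => hh.curry b a }
  obtain ⟨F, hF⟩ := Module.projective_lifting_property G H hG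
  refine ⟨TensorProduct.lift (F.restrictScalars k), Intertwines.uncurry fun b a => F.map_smul b a,
    TensorProduct.ext' fun a n => ?_⟩
  exact LinearMap.congr_fun (LinearMap.congr_fun hF a) n

end Lifting

/-! ### Modules over the crossed product as equivariant bimodules -/

section OfModule

variable {k B A : Type*} [Field k] [Ring B] [Bialgebra k B] [Ring A] [Algebra k A]
  [Module B A] [IsScalarTower k B A]

/-- An equivariant map of equivariant bimodules is linear over the crossed product. -/
theorem EquivariantStructure.map_crossAct {Y Z : Type*} [AddCommGroup Y] [Module k Y]
    [AddCommGroup Z] [Module k Z] (D : EquivariantStructure k B A Y)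
    (E : EquivariantStructure k B A Z) (f : Y →ₗ[k] Z) (hρ : Intertwines D.ρ E.ρ f)
    (hl : ∀ a y, f (D.l a y) = E.l a (f y)) (hr : ∀ a y, f (D.r a y) = E.r a (f y))
    (x : CrossedProduct k B A) (y : Y) : f (D.crossAct x y) = E.crossAct x (f y) := by
  induction x using CrossedProduct.induction_on with
  | zero => simp
  | add x x' hx hx' => simp only [map_add, LinearMap.add_apply, hx, hx']
  | mk a a' b =>
    rw [D.crossAct_mk, E.crossAct_mk, hl, hr, hρ]

variable [IsModuleAlgebra k B A]

namespace CrossedProduct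

theorem mk_mul_left (a : A) (x : CrossedProduct k B A) :
    mk a 1 1 * x = (bimodule k B A).l a x := by
  rw [mul_def, EquivariantStructure.crossAct_mk, MulOpposite.op_one, map_one, map_one]
  rfl

theorem mk_mul_right (a : A) (x : CrossedProduct k B A) :
    mk 1 a 1 * x = (bimodule k B A).r (MulOpposite.op a) x := by
  rw [mul_def, EquivariantStructure.crossAct_mk, map_one, map_one]
  rfl

theorem mk_mul_mid (b : B) (x : CrossedProduct k B A) :
    mk 1 1 b * x = (bimodule k B A).ρ b x := by
  rw [mul_def, EquivariantStructure.crossAct_mk, MulOpposite.op_one, map_one, map_one]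
  rfl

/-- Reduces statements about the crossed product to its three subalgebras A, Aᵒᵖ and B. -/
theorem mk_eq_mul (a a' : A) (b : B) :
    (mk a a' b : CrossedProduct k B A) = mk a 1 1 * (mk 1 a' 1 * mk 1 1 b) := by
  rw [mk_mul_left, mk_mul_right]
  change a ⊗ₜ[k] (b ⊗ₜ[k] a') = (a * 1) ⊗ₜ[k] (b ⊗ₜ[k] (1 * a'))
  rw [mul_one, one_mul]

variable (k B A) in
/-- The embedding of `B` into the crossed product. -/
noncomputable def inclMid : B →ₐ[k] CrossedProduct k B A :=
  AlgHom.ofLinearMap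
    (TensorProduct.mk k A (B ⊗[k] A) 1 ∘ₗ (TensorProduct.mk k B A).flip 1) rfl fun b c => by
      refine Eq.trans ?_ (mk_mul_mid b (mk 1 1 c)).symm
      have h := diag_one_left (k := k) (A := A) (diag (act k B B) (act k B A)) b (c ⊗ₜ[k] (1 : A))
      rw [diag_one_right] at h
      exact h.symm

variable (k B A) in
/-- The embedding of `A` into the crossed product. -/
noncomputable def inclLeft : A →ₐ[k] CrossedProduct k B A :=
  AlgHom.ofLinearMap ((TensorProduct.mk k A (B ⊗[k] A)).flip ((1 : B) ⊗ₜ[k] (1 : A))) rfl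
    fun a c => (mk_mul_left a (mk c 1 1)).symm

variable (k B A) in
/-- The embedding of the opposite algebra of `A` into the crossed product. -/
noncomputable def inclRight : Aᵐᵒᵖ →ₐ[k] CrossedProduct k B A :=
  AlgHom.ofLinearMap (TensorProduct.mk k A (B ⊗[k] A) 1 ∘ₗ TensorProduct.mk k B A 1 ∘ₗ
    (MulOpposite.opLinearEquiv k).symm.toLinearMap) rfl
    fun a c => (mk_mul_right a.unop (mk 1 c.unop 1)).symm

theorem inclLeft_apply (a : A) : inclLeft k B A a = mk a 1 1 := rfl

theorem inclRight_apply (a : Aᵐᵒᵖ) : inclRight k B A a = mk 1 a.unop 1 := rfl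

/-- The commutation rule b·a = ∑ b₍₁₎(a)·b₍₂₎. In a module it becomes the compatibility of the left
A-action with B. -/
theorem mk_mid_mul_left (b : B) (a : A) :
    (mk 1 1 b * mk a 1 1 : CrossedProduct k B A) =
      LinearMap.mul' k _ (TensorProduct.map (inclLeft k B A).toLinearMap
        (inclMid k B A).toLinearMap (TensorProduct.map ((act k B A).toLinearMap.flip a)
          LinearMap.id (Coalgebra.comul b))) := by
  rw [mk_mul_mid]
  refine (diag_tmul (act k B A) (diag (act k B B) (act k B A)) b a ((1 : B) ⊗ₜ[k] (1 : A))).trans ?_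
  generalize (Coalgebra.comul (R := k) b) = z
  induction z with
  | zero => simp only [map_zero]; rfl
  | add x y hx hy => simp only [map_add]; rw [← hx, ← hy]; rfl
  | tmul x y =>
    simp only [TensorProduct.map_tmul]
    change (x • a) ⊗ₜ[k] (diag (act k B B) (act k B A) y (1 ⊗ₜ 1)) = mk (x • a) 1 1 * mk 1 1 y
    rw [diag_one_right]
    refine Eq.trans ?_ (mk_mul_left (x • a) (mk 1 1 y)).symm
    change (x • a) ⊗ₜ[k] ((y * 1) ⊗ₜ[k] (1 : A)) = (x • a * 1) ⊗ₜ[k] (y ⊗ₜ[k] (1 : A))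
    rw [mul_one, mul_one]

/-- The same rule for the right copy of A. The legs are swapped because in b(ya) = ∑ b₍₁₎(y)b₍₂₎(a)
the second leg acts on a, while the first is the operator applied to y. -/
theorem mk_mid_mul_right (b : B) (a : A) :
    (mk 1 1 b * mk 1 a 1 : CrossedProduct k B A) =
      LinearMap.mul' k _ (TensorProduct.map
        ((inclRight k B A).toLinearMap ∘ₗ (MulOpposite.opLinearEquiv k).toLinearMap)
        (inclMid k B A).toLinearMap (TensorProduct.map ((act k B A).toLinearMap.flip a)
          LinearMap.id (TensorProduct.comm k B B (Coalgebra.comul b)))) := by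
  rw [mk_mul_mid]
  refine (diag_one_left (k := k) (A := A) (diag (act k B B) (act k B A)) b
    ((1 : B) ⊗ₜ[k] a)).trans ?_
  rw [diag_tmul]
  generalize (Coalgebra.comul (R := k) b) = z
  induction z with
  | zero => simp only [map_zero, TensorProduct.tmul_zero]; rfl
  | add x y hx hy => simp only [map_add, TensorProduct.tmul_add]; rw [← hx, ← hy]; rfl
  | tmul x y =>
    simp only [TensorProduct.map_tmul, TensorProduct.comm_tmul]
    change (1 : A) ⊗ₜ[k] ((x * 1) ⊗ₜ[k] (y • a)) = mk 1 (y • a) 1 * mk 1 1 x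
    refine Eq.trans ?_ (mk_mul_right (y • a) (mk 1 1 x)).symm
    change (1 : A) ⊗ₜ[k] ((x * 1) ⊗ₜ[k] (y • a)) = (1 : A) ⊗ₜ[k] (x ⊗ₜ[k] (1 * y • a))
    rw [mul_one, one_mul]

end CrossedProduct

variable (k B A) in
/-- The equivariant bimodule given by a left module over the crossed product. -/
noncomputable def EquivariantStructure.ofModule (F : Type*) [AddCommGroup F] [Module k F]
    [Module (CrossedProduct k B A) F] [IsScalarTower k (CrossedProduct k B A) F] :
    EquivariantStructure k B A F where
  ρ := (Algebra.lsmul k k F).comp (CrossedProduct.inclMid k B A)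
  l := (Algebra.lsmul k k F).comp (CrossedProduct.inclLeft k B A)
  r := (Algebra.lsmul k k F).comp (CrossedProduct.inclRight k B A)
  comm a a' y := by
    change (CrossedProduct.inclLeft k B A a) • (CrossedProduct.inclRight k B A a') • y =
      (CrossedProduct.inclRight k B A a') • (CrossedProduct.inclLeft k B A a) • y
    rw [CrossedProduct.inclLeft_apply, CrossedProduct.inclRight_apply]
    rw [← mul_smul, ← mul_smul, CrossedProduct.mk_mul_left, CrossedProduct.mk_mul_right]
    congr 1
    change (a * 1) ⊗ₜ[k] ((1 : B) ⊗ₜ[k] a'.unop) = a ⊗ₜ[k] ((1 : B) ⊗ₜ[k] (1 * a'.unop))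
    rw [mul_one, one_mul]
  left := by
    intro b t
    induction t with
    | zero => simp
    | add x y hx hy => simp only [map_add, hx, hy]
    | tmul a y =>
      change _ = (CrossedProduct.mk 1 1 b : CrossedProduct k B A) • (CrossedProduct.mk a 1 1 : CrossedProduct k B A) • y
      rw [← mul_smul, CrossedProduct.mk_mid_mul_left, diag_tmul]
      generalize (Coalgebra.comul (R := k) b) = z
      induction z with
      | zero => simp
      | add x y hx hy => simp only [map_add, add_smul, hx, hy]
      | tmul x z => exact (mul_smul _ _ _).symm
  right := by
    intro b t
    induction t with
    | zero => simp
    | add x y hx hy => simp only [map_add, hx, hy]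
    | tmul y a =>
      change _ = (CrossedProduct.mk 1 1 b : CrossedProduct k B A) • (CrossedProduct.mk 1 a 1 : CrossedProduct k B A) • y
      rw [← mul_smul, CrossedProduct.mk_mid_mul_right, diag_tmul]
      generalize (Coalgebra.comul (R := k) b) = z
      induction z with
      | zero => simp
      | add x y hx hy => simp only [map_add, add_smul, hx, hy]
      | tmul x z => exact (mul_smul _ _ _).symm

theorem EquivariantStructure.ofModule_crossAct (F : Type*) [AddCommGroup F] [Module k F]
    [Module (CrossedProduct k B A) F] [IsScalarTower k (CrossedProduct k B A) F]
    (x : CrossedProduct k B A) (y : F) :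
    (EquivariantStructure.ofModule k B A F).crossAct x y = x • y := by
  induction x using CrossedProduct.induction_on with
  | zero => simp
  | add x x' hx hx' => simp only [map_add, LinearMap.add_apply, add_smul, hx, hx']
  | mk a a' b =>
    rw [EquivariantStructure.crossAct_mk, CrossedProduct.mk_eq_mul, mul_smul, mul_smul]
    rfl

/-! ### Maps out of an induced bimodule -/

variable {M Y : Type*} [AddCommGroup M] [Module k M] [AddCommGroup Y] [Module k Y]
  (D : EquivariantStructure k B A Y)

/-- The map `a ⊗ m ⊗ a' ↦ a h(m) a'`. -/
noncomputable def EquivariantStructure.extend (h : M →ₗ[k] Y) : A ⊗[k] (M ⊗[k] A) →ₗ[k] Y :=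
  TensorProduct.lift D.l.toLinearMap ∘ₗ
    (TensorProduct.lift (D.r.toLinearMap ∘ₗ (MulOpposite.opLinearEquiv k).toLinearMap).flip ∘ₗ
      h.rTensor A).lTensor A

omit [IsModuleAlgebra k B A] in
theorem EquivariantStructure.extend_tmul (h : M →ₗ[k] Y) (a : A) (m : M) (a' : A) :
    D.extend h (a ⊗ₜ (m ⊗ₜ a')) = D.l a (D.r (MulOpposite.op a') (h m)) := rfl

/-- The half of the induction adjunction that is needed: a B-map M → Y extends to a map A ⊗ M ⊗ A →
Y linear over the crossed product. -/
theorem EquivariantStructure.extend_crossAct {σ : B →ₐ[k] Module.End k M} {h : M →ₗ[k] Y}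
    (hh : Intertwines σ D.ρ h) (x : CrossedProduct k B A) (t : A ⊗[k] (M ⊗[k] A)) :
    D.extend h ((EquivariantStructure.induced A σ).crossAct x t) =
      D.crossAct x (D.extend h t) := by
  refine EquivariantStructure.map_crossAct _ D _ ?_ (fun a t => ?_) (fun a t => ?_) x t
  · exact D.left.comp ((D.right.comp (hh.rTensor (act k B A))).lTensor (act k B A))
  · have h1 : D.extend h ∘ₗ (EquivariantStructure.induced A σ).l a = D.l a ∘ₗ D.extend h := by
      refine TensorProduct.ext (LinearMap.ext fun c => TensorProduct.ext' fun m c' => ?_)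
      change D.l (a * c) _ = D.l a (D.l c _)
      rw [map_mul]
      rfl
    exact LinearMap.congr_fun h1 t
  · have h1 : D.extend h ∘ₗ (EquivariantStructure.induced A σ).r a = D.r a ∘ₗ D.extend h := by
      refine TensorProduct.ext (LinearMap.ext fun c => TensorProduct.ext' fun m c' => ?_)
      change D.l c (D.r (MulOpposite.op (c' * a.unop)) (h m)) =
        D.r a (D.l c (D.r (MulOpposite.op c') (h m)))
      rw [← D.comm, MulOpposite.op_mul, MulOpposite.op_unop, map_mul]
      rfl
    exact LinearMap.congr_fun h1 t

end OfModule

/-! ### Projectivity of the terms of the bar complex -/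

section Projective

variable {k B A : Type u} [Field k] [Ring B]  [Ring A] [Algebra k A]

/-- The diagonal action of `B` on `A^{⊗ n}`. -/
noncomputable def tensorPowerAct (k B A : Type u) [Field k] [Ring B] [Bialgebra k B] [Ring A]
    [Algebra k A] [Module B A] [IsScalarTower k B A] : (n : ℕ) → B →ₐ[k] Module.End k (CH k A k n)
  | 0 => (Algebra.ofId k (Module.End k k)).comp (Bialgebra.counitAlgHom k B)
  | n + 1 => diag (act k B A) (tensorPowerAct k B A n)

variable (k A) in
/-- The isomorphism `A^{⊗ n} ⊗ A ≃ CH_n(A, A)`. -/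
noncomputable def tensorPowerEquiv : (n : ℕ) → (CH k A k n ⊗[k] A ≃ₗ[k] CH k A A n)
  | 0 => TensorProduct.lid k A
  | n + 1 => (TensorProduct.assoc k A (CH k A k n) A).trans
      (TensorProduct.congr (LinearEquiv.refl k A) (tensorPowerEquiv n))

section

variable [Bialgebra k B] [Module B A] [IsScalarTower k B A] [IsModuleAlgebra k B A]

/-- In degree 0 this is the counit axiom, with B acting on k through ε; coassociativity gives the
inductive step. -/
theorem tensorPowerEquiv_intertwines (n : ℕ) :
    Intertwines (diag (tensorPowerAct k B A n) (act k B A))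
      (diagAct (EquivariantStructure.of k B A A) n) (tensorPowerEquiv k A n).toLinearMap := by
  induction n with
  | zero =>
    intro b t
    refine TensorProduct.induction_on (motive := fun t : k ⊗[k] A =>
      TensorProduct.lid k A (diag ((Algebra.ofId k (Module.End k k)).comp
        (Bialgebra.counitAlgHom k B)) (act k B A) b t) =
        act k B A b (TensorProduct.lid k A t)) t ?_ (fun c a => ?_) (fun x y hx hy => ?_)
    · simp
    · have h1 : ((Algebra.ofId k (Module.End k k)).comp
          (Bialgebra.counitAlgHom k B)).toLinearMap.flip c =
          LinearMap.toSpanSingleton k k c ∘ₗ Coalgebra.counit := by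
        ext b
        simp [Algebra.ofId_apply, Algebra.algebraMap_eq_smul_one]
      have h2 := Coalgebra.rTensor_counit_comul (R := k) b
      rw [LinearMap.rTensor] at h2
      rw [diag_tmul, h1, ← LinearMap.comp_id ((act k B A).toLinearMap.flip a),
        TensorProduct.map_comp, LinearMap.comp_apply, h2]
      simp
    · simp only [map_add, hx, hy]
  | succ n ih => exact (ih.lTensor (act k B A)).comp (intertwines_assoc _ _ _)

theorem rightMul_tensorPowerEquiv (n : ℕ) (a : A) :
    rightMul (EquivariantStructure.of k B A A) n a ∘ₗ (tensorPowerEquiv k A n).toLinearMap =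
      (tensorPowerEquiv k A n).toLinearMap ∘ₗ (LinearMap.mulRight k a).lTensor _ := by
  induction n with
  | zero =>
    refine TensorProduct.ext' fun (c : k) a' => ?_
    change (c • a') * a = c • (a' * a)
    rw [smul_mul_assoc]
  | succ n ih =>
    refine TensorProduct.ext_threefold fun a' t c => ?_
    change a' ⊗ₜ[k] _ = a' ⊗ₜ[k] _
    exact congrArg _ (LinearMap.congr_fun ih (t ⊗ₜ c))

variable (k A) in
/-- The isomorphism `A ⊗ A^{⊗ n} ⊗ A ≃ CH_{n + 1}(A, A)`. -/
noncomputable def inducedEquiv (n : ℕ) : A ⊗[k] (CH k A k n ⊗[k] A) ≃ₗ[k] CH k A A (n + 1) :=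
  TensorProduct.congr (LinearEquiv.refl k A) (tensorPowerEquiv k A n)

/-- Bar terms are thus induced from the B-modules A^{⊗ n}. -/
theorem inducedEquiv_crossAct (n : ℕ) (x : CrossedProduct k B A)
    (t : A ⊗[k] (CH k A k n ⊗[k] A)) :
    inducedEquiv k A n ((EquivariantStructure.induced A (tensorPowerAct k B A n)).crossAct x t) =
      (CHStructure (EquivariantStructure.of k B A A) (n + 1)).crossAct x
        (inducedEquiv k A n t) := by
  refine EquivariantStructure.map_crossAct _ _ (inducedEquiv k A n).toLinearMap ?_
    (fun a t => ?_) (fun a t => ?_) x t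
  · rw [CHStructure_rho]
    exact (tensorPowerEquiv_intertwines n).lTensor (act k B A)
  · have h1 : (inducedEquiv k A n).toLinearMap ∘ₗ
        (EquivariantStructure.induced A (tensorPowerAct k B A n)).l a =
        (CHStructure (EquivariantStructure.of k B A A) (n + 1)).l a ∘ₗ
          (inducedEquiv k A n).toLinearMap :=
      TensorProduct.ext (LinearMap.ext fun c => TensorProduct.ext' fun m c' => rfl)
    exact LinearMap.congr_fun h1 t
  · have h1 : (inducedEquiv k A n).toLinearMap ∘ₗ
        (EquivariantStructure.induced A (tensorPowerAct k B A n)).r a =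
        rightMul (EquivariantStructure.of k B A A) (n + 1) a.unop ∘ₗ
          (inducedEquiv k A n).toLinearMap := by
      refine TensorProduct.ext (LinearMap.ext fun c => TensorProduct.ext' fun m c' => ?_)
      change c ⊗ₜ[k] _ = c ⊗ₜ[k] _
      exact congrArg _ (LinearMap.congr_fun (rightMul_tensorPowerEquiv n a.unop) (m ⊗ₜ c')).symm
    rw [← CHStructure_r, MulOpposite.op_unop] at h1
    exact LinearMap.congr_fun h1 t

variable (k A) in
/-- The map `A^{⊗ n} → CH_{n + 1}(A, A)`, `m ↦ 1 ⊗ m ⊗ 1`. -/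
noncomputable def inducedUnit (n : ℕ) : CH k A k n →ₗ[k] CH k A A (n + 1) :=
  TensorProduct.mk k A (CH k A A n) 1 ∘ₗ (tensorPowerEquiv k A n).toLinearMap ∘ₗ
    (TensorProduct.mk k (CH k A k n) A).flip 1

theorem inducedUnit_intertwines (n : ℕ) :
    Intertwines (tensorPowerAct k B A n) (diagAct (EquivariantStructure.of k B A A) (n + 1))
      (inducedUnit k A n) := by
  have h1 : Intertwines (diagAct (EquivariantStructure.of k B A A) n)
      (diagAct (EquivariantStructure.of k B A A) (n + 1))
      (TensorProduct.mk k A (CH k A A n) 1) := fun b t => (diag_one_left _ b t).symm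
  exact h1.comp ((tensorPowerEquiv_intertwines n).comp fun b t => (diag_one_right _ b t).symm)

/-- Since a(1 ⊗ m ⊗ 1)a' = a ⊗ m ⊗ a', lifting the unit map of the induced module and extending
yields a lift of the isomorphism itself. -/
theorem extend_inducedUnit (n : ℕ) :
    (CHStructure (EquivariantStructure.of k B A A) (n + 1)).extend (inducedUnit k A n) =
      (inducedEquiv k A n).toLinearMap := by
  refine TensorProduct.ext (LinearMap.ext fun a => TensorProduct.ext' fun m a' => ?_)
  refine (EquivariantStructure.extend_tmul (CHStructure (EquivariantStructure.of k B A A) (n + 1))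
    (inducedUnit k A n) a m a').trans ?_
  rw [CHStructure_r]
  have h := LinearMap.congr_fun (rightMul_tensorPowerEquiv (B := B) n a') (m ⊗ₜ (1 : A))
  change (a * 1) ⊗ₜ[k] (rightMul (EquivariantStructure.of k B A A) n a'
    (tensorPowerEquiv k A n (m ⊗ₜ (1 : A)))) = a ⊗ₜ[k] (tensorPowerEquiv k A n (m ⊗ₜ a'))
  refine (congrArg (TensorProduct.mk k A (CH k A A n) (a * 1)) h).trans ?_
  change (a * 1) ⊗ₜ[k] (tensorPowerEquiv k A n (m ⊗ₜ (1 * a'))) = _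
  rw [mul_one, one_mul]

end

/-! ### Projectivity over the crossed product. -/

variable [HopfAlgebra k B] [Module B A] [IsScalarTower k B A] [IsModuleAlgebra k B A]

/-- If `A` is a projective `B`-module, then `A^{⊗ (n + 3)}` is projective over the crossed
product. -/
instance projective_CH [Module.Projective B A] (n : ℕ) :
    Module.Projective (CrossedProduct k B A) (CH k A A (n + 2)) := by
  -- It suffices to split a surjection f from a free module F.
  refine Module.Projective.of_lifting_property'' fun f hf => ?_
  let F := CH k A A (n + 2) →₀ CrossedProduct k B A
  let E := EquivariantStructure.ofModule k B A F
  let g : F →ₗ[k] CH k A A (n + 2) := f.restrictScalars k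
  have hg : Intertwines E.ρ (diagAct (EquivariantStructure.of k B A A) (n + 2)) g := fun b y =>
    (f.map_smul (CrossedProduct.mk 1 1 b) y).trans (bar_mk_smul_mid (n + 2) b (f y))
  obtain ⟨h, hh, hgh⟩ : ∃ h : CH k A k (n + 1) →ₗ[k] F,
      Intertwines (tensorPowerAct k B A (n + 1)) E.ρ h ∧ g ∘ₗ h = inducedUnit k A (n + 1) :=
    -- The inner part A^{⊗(n+1)} is A ⊗ N with N = A^{⊗ n}; the index n + 2 in the statement
    -- guarantees this inner copy of A.
    hg.exists_lift (τ := tensorPowerAct k B A n) hf (inducedUnit_intertwines (n + 1))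
  have hext : ∀ t, g (E.extend h t) = inducedEquiv k A (n + 1) t := by
    intro t
    rw [← LinearEquiv.coe_coe, ← extend_inducedUnit (B := B), ← hgh]
    suffices H : g ∘ₗ E.extend h =
        (CHStructure (EquivariantStructure.of k B A A) (n + 2)).extend (g ∘ₗ h) from
      LinearMap.congr_fun H t
    refine TensorProduct.ext (LinearMap.ext fun a => TensorProduct.ext' fun m a' => ?_)
    change f ((CrossedProduct.mk a 1 1 : CrossedProduct k B A) •
        (CrossedProduct.mk 1 a' 1 : CrossedProduct k B A) • h m) =
      (CHStructure (EquivariantStructure.of k B A A) (n + 2)).l a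
        ((CHStructure (EquivariantStructure.of k B A A) (n + 2)).r (MulOpposite.op a') (f (h m)))
    rw [f.map_smul, f.map_smul, bar_mk_smul_left, bar_mk_smul_right, CHStructure_r]
  refine ⟨{ toFun := fun y => E.extend h ((inducedEquiv k A (n + 1)).symm y)
            map_add' := fun x y => by rw [map_add, map_add]
            -- The section is the extension of the lift h, transported along the isomorphism with
            -- the induced module.
            map_smul' := fun x y => ?_ }, LinearMap.ext fun y => ?_⟩
  · obtain ⟨t, rfl⟩ := (inducedEquiv k A (n + 1)).surjective y
    rw [bar_smul_def, ← inducedEquiv_crossAct, LinearEquiv.symm_apply_apply,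
      LinearEquiv.symm_apply_apply]
    exact (E.extend_crossAct hh x t).trans (EquivariantStructure.ofModule_crossAct F x _)
  · refine (hext _).trans ?_
    rw [LinearEquiv.apply_symm_apply]
    rfl

end Projective

/-! ### The bar resolution of `Ω(A)` -/

section BarResolution

variable {k B A : Type u} [Field k] [Ring B] [HopfAlgebra k B] [Ring A] [Algebra k A]
  [Module B A] [IsScalarTower k B A] [IsModuleAlgebra k B A]

variable (k A) in
/-- The contracting homotopy `t ↦ 1 ⊗ t` of the bar complex. -/
noncomputable def barHomotopy (n : ℕ) : CH k A A n →ₗ[k] CH k A A (n + 1) :=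
  TensorProduct.mk k A (CH k A A n) 1

/-- With a leading 1, the first face returns t; every other face acts behind the 1, and the shift of
its index flips the sign. -/
theorem barD_succ_barHomotopy (n : ℕ) (t : CH k A A (n + 1)) :
    barD (EquivariantStructure.of k B A A) (n + 1) (barHomotopy k A (n + 1) t) =
      t - barHomotopy k A n (barD (EquivariantStructure.of k B A A) n t) := by
  have h0 : innerFace (EquivariantStructure.of k B A A) (n + 1) 0 (barHomotopy k A (n + 1) t) =
    t := one_smul A (show A ⊗[k] CH k A A n from t)
  have h1 : ∀ j : Fin (n + 1), innerFace (EquivariantStructure.of k B A A) (n + 1) j.succ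
      (barHomotopy k A (n + 1) t) =
      barHomotopy k A n (innerFace (EquivariantStructure.of k B A A) n j t) := fun j => rfl
  rw [barD, Fin.sum_univ_succ, LinearMap.add_apply, LinearMap.smul_apply, Fin.val_zero, pow_zero,
    one_smul, h0, sub_eq_add_neg]
  congr 1
  rw [barD, LinearMap.sum_apply, LinearMap.sum_apply, map_sum, ← Finset.sum_neg_distrib]
  refine Finset.sum_congr rfl fun j _ => ?_
  rw [LinearMap.smul_apply, LinearMap.smul_apply, map_smul, h1, Fin.val_succ, pow_succ,
    mul_neg_one, neg_smul]

variable (k B A) in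
theorem barD_zero : barD (EquivariantStructure.of k B A A) 0 =
    innerFace (EquivariantStructure.of k B A A) 0 0 := by
  rw [barD, Fin.sum_univ_one, Fin.val_zero, pow_zero, one_smul]

variable (k B A) in
theorem barD_zero_eq_mul' : barD (EquivariantStructure.of k B A A) 0 = LinearMap.mul' k A :=
  (barD_zero k B A).trans (TensorProduct.ext' fun _ _ => rfl)

variable (k B A) in
theorem barD_one : barD (EquivariantStructure.of k B A A) 1 =
    innerFace (EquivariantStructure.of k B A A) 1 0 -
      innerFace (EquivariantStructure.of k B A A) 1 1 := by
  rw [barD, Fin.sum_univ_two, Fin.val_zero, pow_zero, one_smul, Fin.val_one, pow_one, neg_smul,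
    one_smul, sub_eq_add_neg]

/-- Only the first face involves the outer left factor, where associativity suffices. -/
theorem innerFace_l (n : ℕ) (j : Fin (n + 1)) (a : A) :
    innerFace (EquivariantStructure.of k B A A) n j ∘ₗ
        (CHStructure (EquivariantStructure.of k B A A) (n + 1)).l a =
      (CHStructure (EquivariantStructure.of k B A A) n).l a ∘ₗ
        innerFace (EquivariantStructure.of k B A A) n j := by
  cases n with
  | zero => exact TensorProduct.ext' fun a' (c : A) => mul_assoc a a' c
  | succ n =>
    induction j using Fin.cases with
    | zero =>
      refine tensor_ext2 fun a' a'' t => ?_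
      change (a * a' * a'') ⊗ₜ[k] t = (a * (a' * a'')) ⊗ₜ[k] t
      rw [mul_assoc]
    | succ j => exact TensorProduct.ext' fun a' t => rfl

theorem innerFace_smul (n : ℕ) (j : Fin (n + 1)) (x : CrossedProduct k B A)
    (t : CH k A A (n + 1)) :
    innerFace (EquivariantStructure.of k B A A) n j
        ((CHStructure (EquivariantStructure.of k B A A) (n + 1)).crossAct x t) =
      (CHStructure (EquivariantStructure.of k B A A) n).crossAct x
        (innerFace (EquivariantStructure.of k B A A) n j t) := by
  refine EquivariantStructure.map_crossAct _ _ _ ?_ (fun a t => ?_) (fun a t => ?_) x t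
  · rw [CHStructure_rho, CHStructure_rho]
    exact innerFace_intertwines _ n j
  · exact LinearMap.congr_fun (innerFace_l n j a) t
  · have h := LinearMap.congr_fun
      (innerFace_rightMul (EquivariantStructure.of k B A A) n j a.unop) t
    rw [← CHStructure_r, ← CHStructure_r, MulOpposite.op_unop] at h
    exact h

end BarResolution

/-! ### The bar complex as a projective resolution over the crossed product. -/

section BarResolution

variable (k B A : Type u) [Field k] [Ring B] [HopfAlgebra k B] [Ring A] [Algebra k A]
  [Module B A] [IsScalarTower k B A] [IsModuleAlgebra k B A]

/-- The differential of the bar complex as a map of modules over the crossed product. -/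
noncomputable def barMap (n : ℕ) : CH k A A (n + 1) →ₗ[CrossedProduct k B A] CH k A A n where
  toFun := barD (EquivariantStructure.of k B A A) n
  map_add' := map_add _
  map_smul' x t := by
    change barD (EquivariantStructure.of k B A A) n
        ((CHStructure (EquivariantStructure.of k B A A) (n + 1)).crossAct x t) =
      (CHStructure (EquivariantStructure.of k B A A) n).crossAct x
        (barD (EquivariantStructure.of k B A A) n t)
    simp only [barD, LinearMap.sum_apply, LinearMap.smul_apply, map_sum, map_smul, innerFace_smul]

theorem barMap_apply (n : ℕ) (t : CH k A A (n + 1)) :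
    barMap k B A n t = barD (EquivariantStructure.of k B A A) n t := rfl

/-- This degree lies below the range of `alternating_comp`, which starts with two faces in the outer
differential; it is associativity of A. -/
theorem barMap_zero_comp : barMap k B A 0 ∘ₗ barMap k B A 1 = 0 := by
  refine LinearMap.ext fun t => ?_
  suffices h : barD (EquivariantStructure.of k B A A) 0 ∘ₗ
      barD (EquivariantStructure.of k B A A) 1 = 0 from LinearMap.congr_fun h t
  have h := innerFace_innerFace (EquivariantStructure.of k B A A) 0 0 0 le_rfl
  rw [barD_zero, barD_one, LinearMap.comp_sub, sub_eq_zero]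
  exact h.symm

theorem barMap_succ_comp (n : ℕ) : barMap k B A (n + 1) ∘ₗ barMap k B A (n + 2) = 0 :=
  LinearMap.ext fun t => LinearMap.congr_fun
    (alternating_comp n (innerFace (EquivariantStructure.of k B A A) (n + 1))
      (innerFace (EquivariantStructure.of k B A A) (n + 2))
      (innerFace_innerFace (EquivariantStructure.of k B A A) (n + 1))) t

/-- A cycle t bounds 1 ⊗ t. The homotopy is only k-linear, which is enough for exactness. -/
theorem barMap_exact (n : ℕ) (t : CH k A A (n + 1)) (ht : barMap k B A n t = 0) :
    ∃ s, barMap k B A (n + 1) s = t := by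
  refine ⟨barHomotopy k A (n + 1) t, (barD_succ_barHomotopy n t).trans ?_⟩
  rw [← barMap_apply, ht, map_zero, sub_zero]

/-- The augmentation `A ⊗ A ⊗ A → Ω(A)`. -/
noncomputable def barAug : CH k A A 2 →ₗ[CrossedProduct k B A] Omega k B A where
  toFun t := ⟨barMap k B A 1 t, by
    refine LinearMap.mem_ker.2 ?_
    exact (LinearMap.congr_fun (barD_zero_eq_mul' k B A) _).symm.trans
      (LinearMap.congr_fun (barMap_zero_comp k B A) t)⟩
  map_add' x y := Subtype.ext ((barMap k B A 1).map_add x y)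
  map_smul' r x := Subtype.ext ((barMap k B A 1).map_smul r x)

theorem barAug_surjective : Function.Surjective (barAug k B A) := by
  rintro ⟨t, ht⟩
  obtain ⟨s, hs⟩ := barMap_exact k B A 0 t ((LinearMap.congr_fun (barD_zero_eq_mul' k B A) t).trans ht)
  exact ⟨s, Subtype.ext hs⟩

/-- The bar complex `⋯ → A^{⊗ 4} → A^{⊗ 3}`. -/
noncomputable def barComplex : ChainComplex (ModuleCat.{u} (CrossedProduct k B A)) ℕ :=
  ChainComplex.of (fun n => ModuleCat.of (CrossedProduct k B A) (CH k A A (n + 2)))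
    (fun n => ModuleCat.ofHom (barMap k B A (n + 2)))
    (fun n => ModuleCat.hom_ext (barMap_succ_comp k B A (n + 1)))

theorem barComplex_d (n : ℕ) :
    (barComplex k B A).d (n + 1) n = ModuleCat.ofHom (barMap k B A (n + 2)) :=
  ChainComplex.of_d (fun n => ModuleCat.of (CrossedProduct k B A) (CH k A A (n + 2)))
    (fun n => ModuleCat.ofHom (barMap k B A (n + 2))) n

theorem barComplex_d_barAug :
    (barComplex k B A).d 1 0 ≫
      (ModuleCat.ofHom (barAug k B A) : (barComplex k B A).X 0 ⟶ ModuleCat.of _ _) = 0 := by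
  rw [barComplex_d]
  refine ModuleCat.hom_ext (LinearMap.ext fun t => Subtype.ext ?_)
  exact LinearMap.congr_fun (barMap_succ_comp k B A 0) t

theorem barComplex_exactAt_succ (n : ℕ) : (barComplex k B A).ExactAt (n + 1) := by
  rw [HomologicalComplex.exactAt_iff' _ (n + 2) (n + 1) n (by simp) (by simp),
    ShortComplex.moduleCat_exact_iff]
  intro (t : CH k A A (n + 3)) ht
  change ((barComplex k B A).d (n + 1) n).hom t = 0 at ht
  rw [barComplex_d] at ht
  obtain ⟨s, hs⟩ := barMap_exact k B A (n + 2) t ht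
  refine ⟨s, ?_⟩
  change ((barComplex k B A).d (n + 2) (n + 1)).hom s = t
  rw [barComplex_d]
  exact hs

/-- The bar resolution of `Ω(A)` over the crossed product. -/
noncomputable def barResolution [Module.Projective B A] :
    ProjectiveResolution (ModuleCat.of (CrossedProduct k B A) (Omega k B A)) where
  complex := barComplex k B A
  projective n := (IsProjective.iff_projective (CH k A A (n + 2))).1 (projective_CH n)
  π := (ChainComplex.toSingle₀Equiv _ _).symm
    ⟨ModuleCat.ofHom (barAug k B A), barComplex_d_barAug k B A⟩
  quasiIso := ⟨fun n => by
    cases n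
    -- In degree 0 the claim is that A^{⊗4} → A^{⊗3} → Ω(A) → 0 is exact; the isomorphism below only
    -- puts the augmentation in explicit form.
    · rw [ChainComplex.quasiIsoAt₀_iff, ShortComplex.quasiIso_iff_of_zeros']
      · dsimp
        refine (ShortComplex.exact_and_epi_g_iff_of_iso (S₂ := ShortComplex.mk _ _
          (barComplex_d_barAug k B A)) ?_).2 ⟨?_, ?_⟩
        · exact ShortComplex.isoMk (Iso.refl _) (Iso.refl _) (Iso.refl _)
            ((Category.id_comp _).trans (Category.comp_id _).symm)
            ((Category.id_comp _).trans
              ((ChainComplex.toSingle₀Equiv_symm_apply_f_zero _ (barComplex_d_barAug k B A)).symm.trans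
                (Category.comp_id _).symm))
        · rw [ShortComplex.moduleCat_exact_iff]
          intro (t : CH k A A 2) ht
          -- As Ω(A) sits inside A ⊗ A, the kernel of the augmentation is the kernel of the bar
          -- differential.
          obtain ⟨s, hs⟩ := barMap_exact k B A 1 t (congrArg Subtype.val ht)
          refine ⟨s, ?_⟩
          change ((barComplex k B A).d 1 0).hom s = t
          rw [barComplex_d]
          exact hs
        · exact (ModuleCat.epi_iff_surjective _).2 (barAug_surjective k B A)
      all_goals rfl
    · rw [quasiIsoAt_iff_exactAt']
      · exact barComplex_exactAt_succ k B A _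
      · apply ChainComplex.exactAt_succ_single_obj⟩

end BarResolution

/-! ### The tensor product functor on a module with a given `k`-structure -/

section TensorFunctor

open scoped ModuleCat

variable (k R W : Type u) [Field k] [Ring R] [Algebra k R] [AddCommGroup W] [Module k W]
  [Module Rᵐᵒᵖ W]

variable {M N : ModuleCat.{u} R} {Y Z : Type u} [AddCommGroup Y] [Module k Y] [Module R Y]
  [IsScalarTower k R Y] [AddCommGroup Z] [Module k Z] [Module R Z] [IsScalarTower k R Z]

/-- `W ⊗_R M`, computed on a module `Y ≃ M` with a given `k`-structure. -/
noncomputable def tensorFunctorObjEquiv (e : M ≃ₗ[R] Y) : (tensorFunctor k R W).obj M ≃ₗ[k]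
    (W ⊗[k] Y) ⧸ balancedRelations k R W Y :=
  Submodule.Quotient.equiv (balancedRelations k R W M) (balancedRelations k R W Y)
    -- The functor restricts scalars along k → R; the scalar tower hypothesis says that this agrees
    -- with the given k-structure on Y.
    (TensorProduct.congr (LinearEquiv.refl k W) (e.restrictScalars k)) (by
      refine (Submodule.map_span _ _).trans (congrArg (Submodule.span k) (Set.ext fun t => ?_))
      constructor
      · rintro ⟨_, ⟨w, r, y, rfl⟩, rfl⟩
        exact ⟨w, r, e y, by simp⟩
      · rintro ⟨w, r, y, rfl⟩
        exact ⟨_, ⟨w, r, e.symm y, rfl⟩, by simp⟩)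

theorem tensorFunctorObjEquiv_map (e : M ≃ₗ[R] Y) (e' : N ≃ₗ[R] Z) (f : M ⟶ N) (w : W) (y : Y) :
    tensorFunctorObjEquiv k R W e' ((tensorFunctor k R W).map f
      ((tensorFunctorObjEquiv k R W e).symm ((balancedRelations k R W Y).mkQ (w ⊗ₜ y)))) =
      (balancedRelations k R W Z).mkQ (w ⊗ₜ e' (f.hom (e.symm y))) := rfl

end TensorFunctor

/-! ### The comparison isomorphism -/

section Main

variable (k B A V : Type u) [Field k] [Ring B] [HopfAlgebra k B]
  [Ring A] [Algebra k A] [Module B A] [IsScalarTower k B A] [IsModuleAlgebra k B A]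
  [AddCommGroup V] [Module k V] [Module A V] [IsScalarTower k A V]
  [Module Aᵐᵒᵖ V] [IsScalarTower k Aᵐᵒᵖ V] [SMulCommClass A Aᵐᵒᵖ V]
  [Module B V] [IsScalarTower k B V] [IsEquivariantBimodule k B A V]

/-- The isomorphism between `Vᵒᵖ ⊗ A^{⊗ (n + 2)}` and `k ⊗_B QCH_n(A, B, V)`, for the tensor
product functor over the crossed product. -/
noncomputable def comparisonEquiv (n : ℕ) :
    (tensorFunctor k (CrossedProduct k B A) (Op k B A V)).obj
      (ModuleCat.of (CrossedProduct k B A) (CH k A A (n + 1))) ≃ₗ[k]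
    BQCH (EquivariantStructure.of k B A V) n :=
  (tensorFunctorObjEquiv k (CrossedProduct k B A) (Op k B A V)
    (LinearEquiv.refl (CrossedProduct k B A) (CH k A A (n + 1)))).trans
    (tensorBarEquiv k B A V n)

/-- After reduction to the classes [v] ⊗ y, which generate, this is `barToBQCH_barD`. -/
theorem comparisonEquiv_map (n : ℕ)
    (z : (tensorFunctor k (CrossedProduct k B A) (Op k B A V)).obj
      (ModuleCat.of (CrossedProduct k B A) (CH k A A (n + 2)))) :
    comparisonEquiv k B A V n ((tensorFunctor k (CrossedProduct k B A) (Op k B A V)).map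
      (ModuleCat.ofHom (barMap k B A (n + 1))) z) =
      bqD (EquivariantStructure.of k B A V) n (comparisonEquiv k B A V (n + 1) z) := by
  let e := tensorFunctorObjEquiv k (CrossedProduct k B A) (Op k B A V)
    (M := ModuleCat.of (CrossedProduct k B A) (CH k A A (n + 2)))
    (LinearEquiv.refl (CrossedProduct k B A) (CH k A A (n + 2)))
  obtain ⟨z, rfl⟩ := e.symm.surjective z
  obtain ⟨x, rfl⟩ := Generated.tensorMk_surjective (opAct k B A V) z
  have h1 : comparisonEquiv k B A V (n + 1) (e.symm (Generated.tensorMk _ (opAct k B A V) x)) =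
      barToBQCH k B A V (n + 1) x := by
    rw [comparisonEquiv, LinearEquiv.trans_apply, LinearEquiv.apply_symm_apply,
      tensorBarEquiv_tensorMk]
  rw [h1, ← barToBQCH_barD, ← tensorBarEquiv_tensorMk, comparisonEquiv, LinearEquiv.trans_apply]
  congr 1
  clear h1
  induction x with
  | zero => simp only [map_zero]
  | add x y hx hy => simp only [map_add, hx, hy]
  | tmul y v =>
    exact tensorFunctorObjEquiv_map k (CrossedProduct k B A) (Op k B A V)
      (LinearEquiv.refl (CrossedProduct k B A) (CH k A A (n + 2)))
      (LinearEquiv.refl (CrossedProduct k B A) (CH k A A (n + 1)))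
      (ModuleCat.ofHom (barMap k B A (n + 1))) _ y

theorem hopfHochschildComplex_d (n : ℕ) :
    (hopfHochschildComplex (EquivariantStructure.of k B A V)).d (n + 1) n =
      ModuleCat.ofHom (bqD (EquivariantStructure.of k B A V) n) :=
  ChainComplex.of_d (fun n => ModuleCat.of k (BQCH (EquivariantStructure.of k B A V) n))
    (fun n => ModuleCat.ofHom (bqD (EquivariantStructure.of k B A V) n)) n

/-- The comparison of the short complexes that compute the two homology modules. -/
noncomputable def comparisonShortComplex (n : ℕ) :
    (((tensorFunctor k (CrossedProduct k B A) (Op k B A V)).mapHomologicalComplex _).obj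
      (barComplex k B A)).sc' (n + 2) (n + 1) n ≅
    (hopfHochschildComplex (EquivariantStructure.of k B A V)).sc' (n + 3) (n + 2) (n + 1) :=
  -- The bar term in degree i is `CH k A A (i + 2)` and `comparisonEquiv` sends it to QCH in degree
  -- i + 1; hence the shift by one.
  ShortComplex.isoMk (comparisonEquiv k B A V (n + 3)).toModuleIso
    (comparisonEquiv k B A V (n + 2)).toModuleIso (comparisonEquiv k B A V (n + 1)).toModuleIso
    (by
      change (comparisonEquiv k B A V (n + 3)).toModuleIso.hom ≫
        (hopfHochschildComplex (EquivariantStructure.of k B A V)).d (n + 3) (n + 2) =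
        (tensorFunctor k (CrossedProduct k B A) (Op k B A V)).map
          ((barComplex k B A).d (n + 2) (n + 1)) ≫
          (comparisonEquiv k B A V (n + 2)).toModuleIso.hom
      rw [barComplex_d, hopfHochschildComplex_d]
      exact ModuleCat.hom_ext (LinearMap.ext fun z => (comparisonEquiv_map k B A V (n + 2) z).symm))
    (by
      change (comparisonEquiv k B A V (n + 2)).toModuleIso.hom ≫
        (hopfHochschildComplex (EquivariantStructure.of k B A V)).d (n + 2) (n + 1) =
        (tensorFunctor k (CrossedProduct k B A) (Op k B A V)).map
          ((barComplex k B A).d (n + 1) n) ≫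
          (comparisonEquiv k B A V (n + 1)).toModuleIso.hom
      rw [barComplex_d, hopfHochschildComplex_d]
      exact ModuleCat.hom_ext (LinearMap.ext fun z => (comparisonEquiv_map k B A V (n + 1) z).symm))

/-- The comparison of the Hopf-Hochschild homology with `Tor` in positive degrees. -/
noncomputable def homologyIsoTor [Module.Projective B A] (n : ℕ) :
    HH k B A V (n + 2) ≅
      Tor k (CrossedProduct k B A) (Op k B A V) (Omega k B A) (n + 1) :=
  (hopfHochschildComplex (EquivariantStructure.of k B A V)).homologyIsoSc'
      (n + 3) (n + 2) (n + 1) (by simp) (by simp) ≪≫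
    ShortComplex.homologyMapIso (comparisonShortComplex k B A V n).symm ≪≫
    (HomologicalComplex.homologyIsoSc' _ (n + 2) (n + 1) n (by simp) (by simp)).symm ≪≫
    ((barResolution k B A).isoLeftDerivedObj
      (tensorFunctor k (CrossedProduct k B A) (Op k B A V)) (n + 1)).symm

end Main

end HopfHochschild

theorem mainTheorem4 {k B A V : Type u} [Field k] [Ring B] [HopfAlgebra k B]
    (hS : Function.Bijective (HopfAlgebra.antipode k : B →ₗ[k] B))
    [Ring A] [Algebra k A] [Module B A] [IsScalarTower k B A]
    [HopfHochschild.IsModuleAlgebra k B A] [Module.Projective B A]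
    [AddCommGroup V] [Module k V] [Module A V] [IsScalarTower k A V]
    [Module Aᵐᵒᵖ V] [IsScalarTower k Aᵐᵒᵖ V] [SMulCommClass A Aᵐᵒᵖ V]
    [Module B V] [IsScalarTower k B V] [HopfHochschild.IsEquivariantBimodule k B A V]
    (n : ℕ) (hn : 1 ≤ n) :
    Nonempty (HopfHochschild.HH k B A V (n + 1) ≃ₗ[k]
      HopfHochschild.Tor k (HopfHochschild.CrossedProduct k B A) (HopfHochschild.Op k B A V)
        (HopfHochschild.Omega k B A) n) := by
  -- Writing the degree as n + 1 provides a bar term below it, so the homology is that of three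
  -- consecutive terms which all match. In degree 0 the term QCH₀ would have no counterpart.
  obtain ⟨n, rfl⟩ := Nat.exists_eq_add_of_le' hn
  exact ⟨(HopfHochschild.homologyIsoTor k B A V n).toLinearEquiv⟩
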